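/- Let $K$ be a field, $R=K[x_1,\dots,x_n]$ with its standard grading and $\mathfrak m=(x_1,\dots,x_n)$. For a finitely generated graded nonzero $R$-module $M$ and $0\le j\le \operatorname{pd}_R(M)$ let $t_j(M)$ be the largest degree of a minimal generator of the $j$-th syzygy module of $M$, i.e. the largest degree of a basis element of $F_j$ in a minimal graded free resolution $F_\bullet$ of $M$; put $t_j(M)=-\infty$ for $j>\operatorname{pd}_R(M)$, and $\operatorname{reg}(M)=\max\{t_j(M)-j : j\ge 0\}$. Let $I_1,\dots,I_m$ be nonzero ideals of $R$ such that, for each $i$, the ideal $I_i$ is generated by homogeneous polynomials of a single degree $d_i$. For $a\in\mathbb N^m$ write $I^a=I_1^{a_1}\cdots I_m^{a_m}$, and say that a property holds for $a\gg 0$ if there is $b\in\mathbb N^m$ such that it holds for every $a\in b+\mathbb N^m$. Then: 1. $\operatorname{pd}_R(I^a)$ is constant for $a\gg0$, say equal to $p$. 2. For each $j$ with $0\le j\le p$ there is $\lambda^{(j)}_0\in\mathbb Z$ such that $t_j(I^a)=\sum_{i=1}^m d_ia_i+\lambda^{(j)}_0$ for $a\gg0$. 3. There is $\lambda_0\in\mathbb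 Z$ such that $\operatorname{reg}(I^a)=\sum_{i=1}^m d_ia_i+\lambda_0$ for $a\gg0$. -/

import Mathlib

noncomputable section

/-- The standard `ℤ`-grading of the polynomial ring `K[x₁, …, xₙ]`: the forms of degree `v`
(only `0` when `v < 0`). -/
def polyComp (K : Type*) [Field K] (n : ℕ) : ℤ → Submodule K (MvPolynomial (Fin n) K)
  | Int.ofNat k => MvPolynomial.homogeneousSubmodule (Fin n) K k
  | Int.negSucc _ => ⊥

/-- The grading of an ideal `I` of `K[x₁, …, xₙ]` inherited from the polynomial ring. -/
def idealComp {K : Type*} [Field K] {n : ℕ} (I : Ideal (MvPolynomial (Fin n) K)) (v : ℤ) :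
    Submodule K I :=
  (polyComp K n v).comap (I.subtype.restrictScalars K)

/-- The homogeneous maximal ideal `(x₁, …, xₙ)`. -/
def irrelevantIdeal (K : Type*) [Field K] (n : ℕ) : Ideal (MvPolynomial (Fin n) K) :=
  Ideal.span (Set.range MvPolynomial.X)

/-- A minimal graded free resolution `⋯ → F₁ → F₀ → M → 0` of a graded module `M` over
`R = K[x₁, …, xₙ]`, where `𝓜 v` is the component of `M` of degree `v`. Here `F j` is the graded
free module `⨁ₖ R(-deg j k)`, i.e. `R ^ rank j` with the `k`-th basis vector in degree `deg j k`;
an element of `F j` is homogeneous of degree `u` when its `i`-th coordinate is a form of degree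
`u - deg j i` for every `i`. -/
structure MinimalGradedFreeResolution {K : Type*} [Field K] {n : ℕ} {M : Type*} [AddCommGroup M]
    [Module K M] [Module (MvPolynomial (Fin n) K) M] [IsScalarTower K (MvPolynomial (Fin n) K) M]
    (𝓜 : ℤ → Submodule K M) where
  /-- the rank of `F j` -/
  rank : ℕ → ℕ
  /-- the degrees of the basis vectors of `F j` -/
  deg : ∀ j : ℕ, Fin (rank j) → ℤ
  /-- the differential `F (j + 1) → F j` -/
  d : ∀ j : ℕ, (Fin (rank (j + 1)) → MvPolynomial (Fin n) K) →ₗ[MvPolynomial (Fin n) K]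
    (Fin (rank j) → MvPolynomial (Fin n) K)
  /-- the augmentation `F 0 → M` -/
  aug : (Fin (rank 0) → MvPolynomial (Fin n) K) →ₗ[MvPolynomial (Fin n) K] M
  aug_surjective : Function.Surjective aug
  exact_zero : Function.Exact (d 0) aug
  exact_succ : ∀ j : ℕ, Function.Exact (d (j + 1)) (d j)
  /-- the augmentation preserves degrees -/
  aug_mem : ∀ k : Fin (rank 0), aug (Pi.single k 1) ∈ 𝓜 (deg 0 k)
  /-- the differentials preserve degrees -/
  d_mem : ∀ (j : ℕ) (k : Fin (rank (j + 1))) (i : Fin (rank j)),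
    d j (Pi.single k 1) i ∈ polyComp K n (deg (j + 1) k - deg j i)
  /-- minimality: the image of `F (j + 1)` lies in `(x₁, …, xₙ) F j` -/
  minimal : ∀ (j : ℕ) (x : Fin (rank (j + 1)) → MvPolynomial (Fin n) K) (i : Fin (rank j)),
    d j x i ∈ irrelevantIdeal K n

/-- `t_j(M)`: the largest degree of a minimal generator of the `j`-th syzygy module of `M`, the
basis vectors of `F j` in a minimal graded free resolution being mapped to a minimal system of
homogeneous generators of that module. It is `-∞` when there are no generators. -/
def maxSyzygyDegree {K : Type*} [Field K] {n : ℕ} {M : Type*} [AddCommGroup M]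
    [Module K M] [Module (MvPolynomial (Fin n) K) M] [IsScalarTower K (MvPolynomial (Fin n) K) M]
    (𝓜 : ℤ → Submodule K M) (j : ℕ) : EReal :=
  ⨆ (F : MinimalGradedFreeResolution (n := n) 𝓜) (k : Fin (F.rank j)), ((F.deg j k : ℝ) : EReal)

/-- The Castelnuovo-Mumford regularity `reg(M) = max {t_j(M) - j : j ≥ 0}`. -/
def gradedRegularity {K : Type*} [Field K] {n : ℕ} {M : Type*} [AddCommGroup M]
    [Module K M] [Module (MvPolynomial (Fin n) K) M] [IsScalarTower K (MvPolynomial (Fin n) K) M]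
    (𝓜 : ℤ → Submodule K M) : EReal :=
  ⨆ j : ℕ, (maxSyzygyDegree (n := n) 𝓜 j - (j : EReal))

/-- The ideal `I` is generated by forms of degree `d`. -/
def GeneratedInDegree {K : Type*} [Field K] {n : ℕ} (I : Ideal (MvPolynomial (Fin n) K))
    (d : ℕ) : Prop :=
  ∃ S : Set (MvPolynomial (Fin n) K), (∀ f ∈ S, f.IsHomogeneous d) ∧ I = Ideal.span S

/-- The product of powers `I^a = I₁^{a₁} ⋯ I_m^{a_m}`. -/
def prodPow {K : Type*} [Field K] {n m : ℕ} (I : Fin m → Ideal (MvPolynomial (Fin n) K))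
    (a : Fin m → ℕ) : Ideal (MvPolynomial (Fin n) K) :=
  ∏ i, I i ^ a i

end

/-! Everything is read off from the Koszul homology of the variables with coefficients in `I^a`,
that is, from Tor with the residue field. In any minimal resolution, shifting dimension along its
short exact sequences shows that the degrees of the basis of `F j` are exactly the degrees in which
the `j`-th Koszul homology is nonzero (`MinimalGradedFreeResolution.hasKoszulHomology_iff`). So it
suffices to show that these degrees, shifted by `d·a`, stabilize
(`exists_finset_hasKoszulHomology_iff`).

For fixed `j` the homogeneous cycles for all `a` together lie in a Noetherian module over the
multi-Rees algebra, so finitely many of them, of shifted degrees `v₀ s`, generate the rest with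
coefficients in `I^(a - s)`. Such a coefficient cannot have degree below `d·(a - s)`. If its degree
is larger, it lies in the maximal ideal times `I^(a - s)`, and variables kill Koszul homology. Hence
only generators with `v₀ s = v` contribute in shifted degree `v`, through coefficients of the least
possible degree. If for some `b` all forms of degree `d·b` in `I^b` kill the class of `s`, then `s`
contributes nothing for large `a`; otherwise it contributes for every large `a`. The limit set is
therefore the set of `v₀ s` with `s` of the second kind.

Projective dimension is the last `j` with nonempty limit set, `t_j` comes from its maximum, and the
regularity is a maximum of finitely many constants. -/

/-! ### Koszul complexes as iterated mapping cones -/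

section Koszul

set_option linter.unusedSectionVars false

/-- The standard basis of the exterior algebra of a free module of rank `k`: words of length `k`
telling which of the generators occur. -/
inductive KoszulIndex : ℕ → Type
  | nil : KoszulIndex 0
  | out {k : ℕ} : KoszulIndex k → KoszulIndex (k + 1)
  | take {k : ℕ} : KoszulIndex k → KoszulIndex (k + 1)

namespace KoszulIndex

/-- The exterior degree. -/
def card : ∀ {k : ℕ}, KoszulIndex k → ℕ
  | _, nil => 0
  | _, out q => card q
  | _, take q => card q + 1

theorem card_le : ∀ {k : ℕ} (q : KoszulIndex k), q.card ≤ k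
  | _, nil => le_rfl
  | _, out q => (card_le q).trans (Nat.le_succ _)
  | _, take q => Nat.succ_le_succ (card_le q)

instance finite : ∀ k : ℕ, Finite (KoszulIndex k)
  | 0 => Finite.of_surjective (fun _ : Unit => nil) fun q => by cases q; exact ⟨(), rfl⟩
  | k + 1 =>
    have := finite k
    Finite.of_surjective (Sum.elim out take : KoszulIndex k ⊕ KoszulIndex k → _) fun q => by
      cases q with
      | out q => exact ⟨Sum.inl q, rfl⟩
      | take q => exact ⟨Sum.inr q, rfl⟩

/-- The basis vector of exterior degree zero. -/
def zero : ∀ k : ℕ, KoszulIndex k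
  | 0 => nil
  | k + 1 => out (zero k)

theorem card_eq_zero : ∀ {k : ℕ} {q : KoszulIndex k}, q.card = 0 ↔ q = zero k
  | _, nil => by simp [card, zero]
  | _, out q => by simp [card, zero, card_eq_zero (q := q)]
  | _, take q => by simp [card, zero]

/-- The function on words of length `k + 1` with given restrictions to the two halves. -/
def pair {M : Type*} {k : ℕ} (a b : KoszulIndex k → M) : KoszulIndex (k + 1) → M
  | out q => a q
  | take q => b q

theorem pair_eta {M : Type*} {k : ℕ} (z : KoszulIndex (k + 1) → M) :
    pair (fun q => z (out q)) (fun q => z (take q)) = z := by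
  funext q; cases q <;> rfl

end KoszulIndex

open KoszulIndex

variable {K R M N : Type*} [CommRing K] [CommRing R] [Algebra K R]
  [AddCommGroup M] [Module R M] [Module K M] [IsScalarTower K R M]
  [AddCommGroup N] [Module R N] [Module K N] [IsScalarTower K R N]

/-- The differential of the Koszul complex of `x 0, …, x (k - 1)` with coefficients in `M`, as an
iterated mapping cone. -/
def koszulD (x : ℕ → R) (M : Type*) [AddCommGroup M] [Module R M] :
    ∀ k : ℕ, (KoszulIndex k → M) →ₗ[R] (KoszulIndex k → M)
  | 0 => 0
  | k + 1 => LinearMap.pi fun q => match q with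
    | out q => LinearMap.proj q ∘ₗ koszulD x M k ∘ₗ LinearMap.funLeft R M out +
        x k • LinearMap.proj (take q)
    | take q => -(LinearMap.proj q ∘ₗ koszulD x M k ∘ₗ LinearMap.funLeft R M take)

variable (x : ℕ → R)

theorem koszulD_pair {k : ℕ} (a b : KoszulIndex k → M) :
    koszulD x M (k + 1) (pair a b) =
      pair (koszulD x M k a + x k • b) (-koszulD x M k b) := by
  funext q; cases q <;> rfl

theorem pair_inj {k : ℕ} {a b a' b' : KoszulIndex k → M} :
    pair a b = pair a' b' ↔ a = a' ∧ b = b' := by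
  constructor
  · intro h
    exact ⟨funext fun q => congrFun h (out q), funext fun q => congrFun h (take q)⟩
  · rintro ⟨rfl, rfl⟩; rfl

theorem pair_zero {k : ℕ} : pair (0 : KoszulIndex k → M) 0 = 0 := by
  funext q; cases q <;> rfl

theorem pair_add {k : ℕ} (a b a' b' : KoszulIndex k → M) :
    pair a b + pair a' b' = pair (a + a') (b + b') := by
  funext q; cases q <;> rfl

theorem smul_pair {k : ℕ} (r : R) (a b : KoszulIndex k → M) :
    r • pair a b = pair (r • a) (r • b) := by
  funext q; cases q <;> rfl

theorem koszulD_koszulD (k : ℕ) (z : KoszulIndex k → M) :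
    koszulD x M k (koszulD x M k z) = 0 := by
  induction k with
  | zero => rfl
  | succ k ih =>
    rw [← pair_eta z, koszulD_pair, koszulD_pair, ← pair_zero, pair_inj]
    simp [ih]

theorem koszulD_comp (p : M →ₗ[R] N) (k : ℕ) (z : KoszulIndex k → M) :
    koszulD x N k (fun q => p (z q)) = fun q => p (koszulD x M k z q) := by
  induction k with
  | zero => funext q; simp [koszulD]
  | succ k ih =>
    rw [← pair_eta z, koszulD_pair]
    have h : (fun q => p (pair (fun q => z (out q)) (fun q => z (take q)) q)) =
        pair (fun q => p (z (out q))) (fun q => p (z (take q))) := by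
      funext q; cases q <;> rfl
    rw [h, koszulD_pair, ih, ih]
    funext q
    cases q <;> simp [pair]

/-- The elements of exterior degree `j` whose coefficients lie in `𝓜 u`. -/
def koszulStrand (𝓜 : ℤ → Submodule K M) (k j : ℕ) (u : ℤ) : Submodule K (KoszulIndex k → M) where
  carrier := {z | ∀ q, z q ∈ 𝓜 u ∧ (q.card ≠ j → z q = 0)}
  add_mem' ha hb q :=
    ⟨add_mem (ha q).1 (hb q).1, fun h => by simp [(ha q).2 h, (hb q).2 h]⟩
  zero_mem' q := ⟨zero_mem _, fun _ => rfl⟩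
  smul_mem' c z hz q := ⟨Submodule.smul_mem _ _ (hz q).1, fun h => by simp [(hz q).2 h]⟩

variable {𝓜 : ℤ → Submodule K M}

theorem pair_mem_koszulStrand {k j : ℕ} {u : ℤ} {a b : KoszulIndex k → M} :
    pair a b ∈ koszulStrand 𝓜 (k + 1) (j + 1) u ↔
      a ∈ koszulStrand 𝓜 k (j + 1) u ∧ b ∈ koszulStrand 𝓜 k j u := by
  constructor
  · intro h
    exact ⟨fun q => h (out q), fun q => ⟨(h (take q)).1, fun hq => (h (take q)).2 (by
      simpa [card] using hq)⟩⟩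
  · rintro ⟨ha, hb⟩ q
    cases q with
    | out q => exact ha q
    | take q => exact ⟨(hb q).1, fun hq => (hb q).2 (by simpa [card] using hq)⟩

theorem pair_mem_koszulStrand_zero {k : ℕ} {u : ℤ} {a b : KoszulIndex k → M} :
    pair a b ∈ koszulStrand 𝓜 (k + 1) 0 u ↔ a ∈ koszulStrand 𝓜 k 0 u ∧ b = 0 := by
  constructor
  · intro h
    exact ⟨fun q => h (out q), funext fun q => (h (take q)).2 (by simp [card])⟩
  · rintro ⟨ha, rfl⟩ q
    cases q with
    | out q => exact ha q
    | take q => exact ⟨zero_mem _, fun _ => rfl⟩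

theorem koszulD_eq_zero {k : ℕ} {u : ℤ} {z : KoszulIndex k → M}
    (hz : z ∈ koszulStrand 𝓜 k 0 u) : koszulD x M k z = 0 := by
  induction k with
  | zero => rfl
  | succ k ih =>
    rw [← pair_eta z, pair_mem_koszulStrand_zero] at hz
    rw [← pair_eta z, koszulD_pair, ih hz.1, hz.2, ← pair_zero]
    simp

variable {x} in
theorem koszulD_mem (hx : ∀ i u, ∀ y ∈ 𝓜 u, x i • y ∈ 𝓜 (u + 1)) {k j : ℕ} {u : ℤ}
    {z : KoszulIndex k → M} (hz : z ∈ koszulStrand 𝓜 k (j + 1) u) :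
    koszulD x M k z ∈ koszulStrand 𝓜 k j (u + 1) := by
  induction k generalizing j with
  | zero => exact zero_mem _
  | succ k ih =>
    rw [← pair_eta z, pair_mem_koszulStrand] at hz
    rw [← pair_eta z, koszulD_pair]
    have key : x k • (fun q => z (take q)) ∈ koszulStrand 𝓜 k j (u + 1) := fun q =>
      ⟨hx _ _ _ (hz.2 q).1, fun h => by simp [(hz.2 q).2 h]⟩
    cases j with
    | zero =>
      rw [pair_mem_koszulStrand_zero]
      exact ⟨add_mem (ih hz.1) key, by rw [koszulD_eq_zero x hz.2, neg_zero]⟩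
    | succ j =>
      rw [pair_mem_koszulStrand]
      exact ⟨add_mem (ih hz.1) key, neg_mem (ih hz.2)⟩

/-- Exterior multiplication by the `i`-th generator. -/
def koszulWedge (R M : Type*) [CommRing R] [AddCommGroup M] [Module R M] (i : ℕ) :
    ∀ k : ℕ, (KoszulIndex k → M) →ₗ[R] (KoszulIndex k → M)
  | 0 => 0
  | k + 1 => LinearMap.pi fun q => match q with
    | out q => if i = k then 0 else
        LinearMap.proj q ∘ₗ koszulWedge R M i k ∘ₗ LinearMap.funLeft R M out
    | take q => if i = k then LinearMap.proj (out q) else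
        -(LinearMap.proj q ∘ₗ koszulWedge R M i k ∘ₗ LinearMap.funLeft R M take)

theorem koszulWedge_pair_self {k : ℕ} (a b : KoszulIndex k → M) :
    koszulWedge R M k (k + 1) (pair a b) = pair 0 a := by
  funext q
  cases q <;> simp [koszulWedge, pair]

theorem koszulWedge_pair {i k : ℕ} (h : i ≠ k) (a b : KoszulIndex k → M) :
    koszulWedge R M i (k + 1) (pair a b) =
      pair (koszulWedge R M i k a) (-koszulWedge R M i k b) := by
  funext q
  cases q <;> simp [koszulWedge, h] <;> rfl

/-- Wedging with the `i`-th generator is a homotopy between multiplication by `x i` and zero; this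
is why each `x i` kills Koszul homology. -/
theorem koszulD_wedge_add {i k : ℕ} (hi : i < k) (z : KoszulIndex k → M) :
    koszulD x M k (koszulWedge R M i k z) + koszulWedge R M i k (koszulD x M k z) = x i • z := by
  induction k with
  | zero => omega
  | succ k ih =>
    rw [← pair_eta z, koszulD_pair]
    by_cases h : i = k
    · subst h
      rw [koszulWedge_pair_self, koszulWedge_pair_self, koszulD_pair, smul_pair, pair_add]
      simp
    · rw [koszulWedge_pair h, koszulWedge_pair h, koszulD_pair, smul_pair, pair_add, pair_inj]
      rw [← ih (by omega), ← ih (by omega)]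
      constructor
      · simp only [map_add, map_smul, smul_neg]
        abel
      · simp

theorem koszulWedge_mem {i k j : ℕ} {u : ℤ} {z : KoszulIndex k → M}
    (hz : z ∈ koszulStrand 𝓜 k j u) :
    koszulWedge R M i k z ∈ koszulStrand 𝓜 k (j + 1) u := by
  induction k generalizing j with
  | zero => exact zero_mem _
  | succ k ih =>
    by_cases h : i = k
    · subst h
      rw [← pair_eta z, koszulWedge_pair_self, pair_mem_koszulStrand]
      exact ⟨zero_mem _, fun q => hz (out q)⟩
    · rw [← pair_eta z] at hz ⊢
      rw [koszulWedge_pair h, pair_mem_koszulStrand]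
      cases j with
      | zero =>
        rw [pair_mem_koszulStrand_zero] at hz
        exact ⟨ih hz.1, by simp [hz.2]⟩
      | succ j =>
        rw [pair_mem_koszulStrand] at hz
        exact ⟨ih hz.1, neg_mem (ih hz.2)⟩

/-- The boundaries of exterior degree `j` that come from coefficients in `𝓜 u`. -/
def koszulBoundary (𝓜 : ℤ → Submodule K M) (k j : ℕ) (u : ℤ) : Submodule K (KoszulIndex k → M) :=
  (koszulStrand 𝓜 k (j + 1) u).map ((koszulD x M k).restrictScalars K)

theorem smul_mem_koszulBoundary {i k j : ℕ} (hi : i < k) {u : ℤ} {z : KoszulIndex k → M}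
    (hz : z ∈ koszulStrand 𝓜 k j u) (hD : koszulD x M k z = 0) :
    x i • z ∈ koszulBoundary x 𝓜 k j u :=
  ⟨koszulWedge R M i k z, koszulWedge_mem hz, by
    have := koszulD_wedge_add x hi z
    rw [hD, map_zero, add_zero] at this
    exact this⟩

theorem mem_koszulBoundary_zero {k : ℕ} {u v : ℤ} {z : KoszulIndex k → M}
    (hz : z ∈ koszulStrand 𝓜 k 0 v) {c : ℕ → M} (hc : ∀ i, c i ∈ 𝓜 u)
    (h : z (zero k) = ∑ i ∈ Finset.range k, x i • c i) : z ∈ koszulBoundary x 𝓜 k 0 u := by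
  classical
  let s : M → KoszulIndex k → M := fun y q => if q.card = 0 then y else 0
  have hs : ∀ i, s (c i) ∈ koszulStrand 𝓜 k 0 u := fun i q => by
    refine ⟨?_, fun hq => by simp [s, hq]⟩
    by_cases hq : q.card = 0
    · simpa [s, hq] using hc i
    · simp [s, hq]
  have : z = ∑ i ∈ Finset.range k, x i • s (c i) := by
    funext q
    by_cases hq : q.card = 0
    · obtain rfl := card_eq_zero.1 hq
      simp [s, hq, ← h]
    · simp [s, hq, (hz q).2 hq]
  rw [this]
  exact sum_mem fun i hi =>
    smul_mem_koszulBoundary x (Finset.mem_range.1 hi) (hs i) (koszulD_eq_zero x (hs i))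

theorem koszulD_apply_zero {k : ℕ} {u : ℤ} {z : KoszulIndex k → M}
    (hz : z ∈ koszulStrand 𝓜 k 1 u) :
    ∃ c : ℕ → M, (∀ i, c i ∈ 𝓜 u) ∧
      koszulD x M k z (zero k) = ∑ i ∈ Finset.range k, x i • c i := by
  induction k with
  | zero => exact ⟨0, fun i => zero_mem _, by simp [koszulD]⟩
  | succ k ih =>
    rw [← pair_eta z, pair_mem_koszulStrand] at hz
    obtain ⟨c, hc, h⟩ := ih hz.1
    rw [← pair_eta z, koszulD_pair]
    refine ⟨fun i => if i = k then z (take (zero k)) else c i, fun i => ?_, ?_⟩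
    · dsimp only
      split_ifs
      · exact (hz.2 _).1
      · exact hc i
    · rw [Finset.sum_range_succ]
      beta_reduce
      rw [if_pos rfl]
      change koszulD x M k _ (zero k) + x k • z (take (zero k)) = _
      rw [h]
      congr 1
      refine Finset.sum_congr rfl fun i hi => ?_
      rw [if_neg (Finset.mem_range.1 hi).ne]

/-- `x 0, …, x (n - 1)` is a regular sequence on `M`, in the graded sense. -/
def GradedRegular (𝓜 : ℤ → Submodule K M) (n : ℕ) : Prop :=
  ∀ k < n, ∀ u : ℤ, ∀ b ∈ 𝓜 u, ∀ c : ℕ → M, x k • b = ∑ i ∈ Finset.range k, x i • c i →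
    ∃ c' : ℕ → M, (∀ i, c' i ∈ 𝓜 (u - 1)) ∧ b = ∑ i ∈ Finset.range k, x i • c' i

-- Induction on the cone: a cycle `(a, b)` has `b` a cycle one exterior degree lower. Once `b = D
-- b'`, the element `a + x k • b'` is a cycle for the shorter sequence, hence some `D a'`, and `(a',
-- -b')` bounds `(a, b)`.
variable {x} in
theorem GradedRegular.acyclic {n : ℕ} (hx : ∀ i u, ∀ y ∈ 𝓜 u, x i • y ∈ 𝓜 (u + 1))
    (h : GradedRegular x 𝓜 n) {k : ℕ} (hk : k ≤ n) {j : ℕ} {u : ℤ} {z : KoszulIndex k → M}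
    (hz : z ∈ koszulStrand 𝓜 k (j + 1) u) (hD : koszulD x M k z = 0) :
    z ∈ koszulBoundary x 𝓜 k (j + 1) (u - 1) := by
  induction k generalizing j u with
  | zero =>
    refine ⟨0, zero_mem _, ?_⟩
    funext q
    cases q
    exact ((hz nil).2 (by simp [card])).symm
  | succ k ih =>
    rw [← pair_eta z, pair_mem_koszulStrand] at hz
    rw [← pair_eta z, koszulD_pair, ← pair_zero, pair_inj, neg_eq_zero] at hD
    rw [← pair_eta z]
    set a := fun q => z (out q)
    set b := fun q => z (take q)
    obtain ⟨b', hb', hbb⟩ : b ∈ koszulBoundary x 𝓜 k j (u - 1) := by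
      cases j with
      | succ j => exact ih (by omega) hz.2 hD.2
      | zero =>
        -- In exterior degree zero the inductive hypothesis is silent; this is the only place where
        -- regularity of `x k` modulo its predecessors enters.
        obtain ⟨c, -, hc⟩ := koszulD_apply_zero x hz.1
        have h1 : x k • b (zero k) = ∑ i ∈ Finset.range k, x i • (-c i) := by
          have := congrFun hD.1 (zero k)
          rw [Pi.add_apply, hc] at this
          simpa using eq_neg_of_add_eq_zero_right this
        obtain ⟨c', hc', h2⟩ := h k (by omega) u _ (hz.2 _).1 _ h1
        exact mem_koszulBoundary_zero x hz.2 hc' h2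
    have hbb : koszulD x M k b' = b := hbb
    obtain ⟨a', ha', haa⟩ := ih (by omega) (j := j) (u := u) (z := a + x k • b')
      (add_mem hz.1 fun q => ⟨by simpa using hx k _ _ (hb' q).1, fun hq => by
        simp [(hb' q).2 hq]⟩) (by rw [map_add, map_smul, hbb, hD.1])
    have haa : koszulD x M k a' = a + x k • b' := haa
    refine ⟨pair a' (-b'), pair_mem_koszulStrand.2 ⟨ha', neg_mem hb'⟩, ?_⟩
    change koszulD x M (k + 1) _ = _
    rw [koszulD_pair, haa, map_neg, hbb]
    simp

/-- The Koszul homology of `x 0, …, x (n - 1)` with coefficients in `M` does not vanish in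
homological degree `j` and internal degree `v`. -/
def HasKoszulHomology (𝓜 : ℤ → Submodule K M) (n j : ℕ) (v : ℤ) : Prop :=
  ∃ z ∈ koszulStrand 𝓜 n j (v - j), koszulD x M n z = 0 ∧
    z ∉ koszulBoundary x 𝓜 n j (v - j - 1)

theorem not_hasKoszulHomology {n j : ℕ} (h : n < j) (v : ℤ) : ¬HasKoszulHomology x 𝓜 n j v := by
  rintro ⟨z, hz, -, hz'⟩
  refine hz' ?_
  have : z = 0 := funext fun q => (hz q).2 ((card_le q).trans_lt h).ne
  exact this ▸ zero_mem _

/-- The zeroth homology is `M / (x 0, …, x (n - 1)) M`, since boundaries of exterior degree zero are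
the combinations of the `x i`. -/
theorem hasKoszulHomology_zero {n : ℕ} {v : ℤ} :
    HasKoszulHomology x 𝓜 n 0 v ↔ ∃ y ∈ 𝓜 v, ∀ c : ℕ → M, (∀ i, c i ∈ 𝓜 (v - 1)) →
      y ≠ ∑ i ∈ Finset.range n, x i • c i := by
  constructor
  · rintro ⟨z, hz, -, hz'⟩
    refine ⟨z (zero n), by simpa using (hz _).1, fun c hc h => hz' ?_⟩
    exact mem_koszulBoundary_zero x hz (by simpa using hc) h
  · rintro ⟨y, hy, h⟩
    classical
    let z : KoszulIndex n → M := fun q => if q.card = 0 then y else 0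
    have hz : z ∈ koszulStrand 𝓜 n 0 (v - (0 : ℕ)) := fun q => by
      refine ⟨?_, fun hq => by simp [z, hq]⟩
      by_cases hq : q.card = 0
      · simpa [z, hq] using hy
      · simp [z, hq]
    refine ⟨z, hz, koszulD_eq_zero x hz, ?_⟩
    rintro ⟨w, hw, hwz⟩
    obtain ⟨c, hc, hcw⟩ := koszulD_apply_zero x hw
    refine h c (by simpa using hc) ?_
    rw [← hcw]
    change y = (koszulD x M n).restrictScalars K w (zero n)
    rw [hwz]
    simp [z, card_eq_zero.2 rfl]

variable {x} in
theorem exists_koszulStrand_lift {p : M →ₗ[R] N} {k j : ℕ} {u : ℤ} {z : KoszulIndex k → N}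
    (hz : z ∈ koszulStrand (fun u => (𝓜 u).map (p.restrictScalars K)) k j u) :
    ∃ y ∈ koszulStrand 𝓜 k j u, (fun q => p (y q)) = z := by
  classical
  choose f hf hfz using fun q => (hz q).1
  refine ⟨fun q => if q.card = j then f q else 0, fun q => ⟨?_, fun h => by simp [h]⟩, ?_⟩
  · dsimp only
    split_ifs
    · exact hf q
    · exact zero_mem _
  · funext q
    by_cases h : q.card = j
    · simpa [h] using hfz q
    · simp [h, (hz q).2 h]

theorem koszulStrand_map {p : M →ₗ[R] N} {k j : ℕ} {u : ℤ} {y : KoszulIndex k → M}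
    (hy : y ∈ koszulStrand 𝓜 k j u) :
    (fun q => p (y q)) ∈ koszulStrand (fun u => (𝓜 u).map (p.restrictScalars K)) k j u :=
  fun q => ⟨⟨y q, (hy q).1, rfl⟩, fun h => by simp [(hy q).2 h]⟩

variable {x} in
/-- Dimension shifting along `0 → ker p → M → p(M) → 0` when the Koszul homology of `M` vanishes in
positive degrees and `ker p` lies in `(x 0, …, x (n - 1)) M`. -/
theorem hasKoszulHomology_succ_map_iff {n : ℕ}
    (hx : ∀ i u, ∀ y ∈ 𝓜 u, x i • y ∈ 𝓜 (u + 1)) (h : GradedRegular x 𝓜 n) (p : M →ₗ[R] N)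
    (hp : ∀ u, ∀ y ∈ 𝓜 u, p y = 0 → ∃ c : ℕ → M, (∀ i, c i ∈ 𝓜 (u - 1)) ∧
      y = ∑ i ∈ Finset.range n, x i • c i) (j : ℕ) (v : ℤ) :
    HasKoszulHomology x (fun u => (𝓜 u).map (p.restrictScalars K)) n (j + 1) v ↔
      HasKoszulHomology x (fun u => 𝓜 u ⊓ (LinearMap.ker p).restrictScalars K) n j v := by
  have e : v - (j + 1 : ℕ) = v - j - 1 := by push_cast; ring
  constructor
  · rintro ⟨z, hz, hD, hz'⟩
    -- Connecting homomorphism: lift the cycle to `M` and differentiate. The result has coefficients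
    -- in `ker p`.
    obtain ⟨y, hy, rfl⟩ := exists_koszulStrand_lift hz
    rw [koszulD_comp] at hD
    have hy' := koszulD_mem hx hy
    rw [e, sub_add_cancel] at hy'
    refine ⟨koszulD x M n y, fun q => ⟨⟨(hy' q).1, congrFun hD q⟩, (hy' q).2⟩,
      koszulD_koszulD x n y, ?_⟩
    rintro ⟨w, hw, hwy⟩
    have hwy : koszulD x M n w = koszulD x M n y := hwy
    have hw' : w ∈ koszulStrand 𝓜 n (j + 1) (v - (j + 1 : ℕ)) := fun q =>
      ⟨e ▸ (hw q).1.1, (hw q).2⟩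
    obtain ⟨t, ht, hty⟩ := h.acyclic hx le_rfl (sub_mem hy hw') (by rw [map_sub, hwy, sub_self])
    have hty : koszulD x M n t = y - w := hty
    refine hz' ⟨fun q => p (t q), koszulStrand_map ht, ?_⟩
    change koszulD x N n _ = _
    rw [koszulD_comp, hty]
    funext q
    have : p (w q) = 0 := (hw q).1.2
    simp [this]
  · rintro ⟨w, hw, hD, hw'⟩
    have hwM : w ∈ koszulStrand 𝓜 n j (v - j) := fun q => ⟨(hw q).1.1, (hw q).2⟩
    -- Surjectivity of the connecting map: `w` must bound in `M`, by acyclicity for `j > 0` and by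
    -- `hp` for `j = 0`.
    obtain ⟨y, hy, hyw⟩ : w ∈ koszulBoundary x 𝓜 n j (v - j - 1) := by
      cases j with
      | zero =>
        obtain ⟨c, hc, hcw⟩ := hp _ _ (hw (zero n)).1.1 (hw (zero n)).1.2
        exact mem_koszulBoundary_zero x hwM hc hcw
      | succ j => exact h.acyclic hx le_rfl hwM hD
    have hyw : koszulD x M n y = w := hyw
    refine ⟨fun q => p (y q), e ▸ koszulStrand_map hy, ?_, ?_⟩
    · rw [koszulD_comp, hyw]
      funext q
      exact (hw q).1.2
    · rintro ⟨z, hz, hzy⟩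
      have hzy : koszulD x N n z = fun q => p (y q) := hzy
      obtain ⟨t, ht, rfl⟩ := exists_koszulStrand_lift hz
      rw [koszulD_comp] at hzy
      have ht' := koszulD_mem hx ht
      rw [sub_add_cancel, e] at ht'
      refine hw' ⟨y - koszulD x M n t, fun q => ⟨⟨(sub_mem hy ht' q).1, ?_⟩,
        (sub_mem hy ht' q).2⟩, ?_⟩
      · have := congrFun hzy q
        simp [this]
      · change koszulD x M n _ = _
        rw [map_sub, koszulD_koszulD, hyw, sub_zero]

end Koszul

/-! ### Gradings on polynomial rings and free modules -/

section GradedPolynomials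

open MvPolynomial

variable {K : Type*} [Field K] {n : ℕ}

theorem mem_polyComp {v : ℤ} {f : MvPolynomial (Fin n) K} :
    f ∈ polyComp K n v ↔ ∀ e, coeff e f ≠ 0 → (e.degree : ℤ) = v := by
  cases v with
  | ofNat k =>
    change f ∈ homogeneousSubmodule (Fin n) K k ↔ _
    rw [mem_homogeneousSubmodule]
    constructor
    · intro h e he
      by_contra h'
      exact he (h.coeff_eq_zero fun h'' => h' (by rw [h'']; rfl))
    · intro h e he
      have := h e he
      refine (DFunLike.congr_fun Finsupp.degree_eq_weight_one e).symm.trans ?_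
      exact Int.ofNat.inj this
  | negSucc k =>
    change f ∈ (⊥ : Submodule K _) ↔ _
    rw [Submodule.mem_bot]
    constructor
    · rintro rfl e he
      simp at he
    · intro h
      ext e
      by_contra he
      have := h e (by simpa using he)
      omega

theorem polyComp_eq_bot {v : ℤ} (hv : v < 0) {f : MvPolynomial (Fin n) K}
    (hf : f ∈ polyComp K n v) : f = 0 := by
  ext e
  by_contra he
  have := mem_polyComp.1 hf e (by simpa using he)
  omega

theorem isHomogeneous_iff_mem_polyComp {d : ℕ} {f : MvPolynomial (Fin n) K} :
    f.IsHomogeneous d ↔ f ∈ polyComp K n d := Iff.rfl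

theorem mul_mem_polyComp {u v : ℤ} {f g : MvPolynomial (Fin n) K} (hf : f ∈ polyComp K n u)
    (hg : g ∈ polyComp K n v) : f * g ∈ polyComp K n (u + v) := by
  classical
  rw [mem_polyComp] at *
  intro e he
  rw [coeff_mul] at he
  obtain ⟨⟨a, b⟩, hab, h⟩ := Finset.exists_ne_zero_of_sum_ne_zero he
  replace hab : a + b = e := Finset.HasAntidiagonal.mem_antidiagonal.1 hab
  rw [← hf a (left_ne_zero_of_mul h), ← hg b (right_ne_zero_of_mul h), ← hab, map_add]
  push_cast
  rfl

/-- The homogeneous component of degree `v`. -/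
noncomputable def polyProj (K : Type*) [Field K] (n : ℕ) (v : ℤ) :
    MvPolynomial (Fin n) K →ₗ[K] MvPolynomial (Fin n) K :=
  if 0 ≤ v then homogeneousComponent v.toNat else 0

theorem coeff_polyProj (v : ℤ) (f : MvPolynomial (Fin n) K) (e : Fin n →₀ ℕ) :
    coeff e (polyProj K n v f) = if (e.degree : ℤ) = v then coeff e f else 0 := by
  unfold polyProj
  split_ifs with h1 h2 h2
  · rw [coeff_homogeneousComponent, if_pos (by omega)]
  · rw [coeff_homogeneousComponent, if_neg (by omega)]
  · omega
  · simp

theorem polyProj_mem (v : ℤ) (f : MvPolynomial (Fin n) K) : polyProj K n v f ∈ polyComp K n v := by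
  rw [mem_polyComp]
  intro e he
  rw [coeff_polyProj] at he
  by_contra h
  simp [h] at he

theorem polyProj_of_mem {v : ℤ} {f : MvPolynomial (Fin n) K} (hf : f ∈ polyComp K n v) :
    polyProj K n v f = f := by
  ext e
  rw [coeff_polyProj]
  split_ifs with h
  · rfl
  · by_contra h'
    exact h (mem_polyComp.1 hf e (Ne.symm h'))

theorem polyProj_mul {w : ℤ} (v : ℤ) (g : MvPolynomial (Fin n) K) {h : MvPolynomial (Fin n) K}
    (hh : h ∈ polyComp K n w) : polyProj K n v (g * h) = polyProj K n (v - w) g * h := by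
  classical
  ext e
  rw [coeff_polyProj, coeff_mul, coeff_mul, ← Finset.sum_const_zero, ← Finset.sum_ite_irrel]
  refine Finset.sum_congr rfl fun ⟨a, b⟩ hab => ?_
  replace hab : a + b = e := Finset.HasAntidiagonal.mem_antidiagonal.1 hab
  rw [coeff_polyProj]
  dsimp only
  by_cases hb : coeff b h = 0
  · simp [hb]
  · have hbw := mem_polyComp.1 hh b hb
    have hdeg : (e.degree : ℤ) = a.degree + b.degree := by rw [← hab, map_add]; push_cast; rfl
    by_cases hv : (e.degree : ℤ) = v
    · rw [if_pos hv, if_pos (by omega)]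
    · rw [if_neg hv, if_neg (by omega), zero_mul]

theorem coeff_zero_polyProj_zero (f : MvPolynomial (Fin n) K) :
    polyProj K n 0 f = C (coeff 0 f) := by
  simp [polyProj]

/-- The sequence of variables, continued by zeros. -/
noncomputable def varSeq (K : Type*) [Field K] (n : ℕ) (i : ℕ) : MvPolynomial (Fin n) K :=
  if h : i < n then X ⟨i, h⟩ else 0

theorem varSeq_mem (i : ℕ) : varSeq K n i ∈ polyComp K n 1 := by
  unfold varSeq
  split_ifs
  · exact isHomogeneous_X _ _
  · exact zero_mem _

/-- An ideal generated by variables is a monomial ideal, so membership is decided on exponents. -/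
theorem mem_span_X_lt {k : ℕ} (hk : k ≤ n) {f : MvPolynomial (Fin n) K} :
    (∃ c : ℕ → MvPolynomial (Fin n) K, f = ∑ i ∈ Finset.range k, varSeq K n i * c i) ↔
      ∀ e, coeff e f ≠ 0 → ∃ i : Fin n, (i : ℕ) < k ∧ e i ≠ 0 := by
  have h1 := mem_ideal_span_X_image (R := K) (x := f) (s := {i : Fin n | (i : ℕ) < k})
  simp only [mem_support_iff, Set.mem_ofPred_eq] at h1
  rw [← h1]
  have h2 : (X '' {i : Fin n | (i : ℕ) < k} : Set (MvPolynomial (Fin n) K)) =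
      varSeq K n '' (Finset.range k : Set ℕ) := by
    ext g
    constructor
    · rintro ⟨i, hi, rfl⟩
      exact ⟨i, by simpa using hi, by simp [varSeq]⟩
    · rintro ⟨i, hi, rfl⟩
      have hi : i < k := by simpa using hi
      exact ⟨⟨i, by omega⟩, hi, by simp [varSeq, show i < n by omega]⟩
  rw [h2]
  constructor
  · rintro ⟨c, rfl⟩
    exact sum_mem fun i hi => Ideal.mul_mem_right _ _ (Ideal.subset_span ⟨i, hi, rfl⟩)
  · intro h
    refine Submodule.span_induction ?_ ⟨0, by simp⟩ ?_ ?_ h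
    · rintro _ ⟨i, hi, rfl⟩
      refine ⟨Pi.single i 1, ?_⟩
      rw [Finset.sum_eq_single_of_mem i hi fun j _ hj => by simp [hj]]
      simp
    · rintro _ _ - - ⟨c, rfl⟩ ⟨c', rfl⟩
      exact ⟨c + c', by simp [mul_add, Finset.sum_add_distrib]⟩
    · rintro a _ - ⟨c, rfl⟩
      exact ⟨a • c, by simp [Finset.mul_sum, mul_left_comm]⟩

theorem exists_graded_sum {k : ℕ} {v : ℤ} {f : MvPolynomial (Fin n) K} (hf : f ∈ polyComp K n v)
    (h : ∃ c : ℕ → MvPolynomial (Fin n) K, f = ∑ i ∈ Finset.range k, varSeq K n i * c i) :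
    ∃ c : ℕ → MvPolynomial (Fin n) K, (∀ i, c i ∈ polyComp K n (v - 1)) ∧
      f = ∑ i ∈ Finset.range k, varSeq K n i * c i := by
  obtain ⟨c, hc⟩ := h
  refine ⟨fun i => polyProj K n (v - 1) (c i), fun i => polyProj_mem _ _, ?_⟩
  conv_lhs => rw [← polyProj_of_mem hf, hc, map_sum]
  refine Finset.sum_congr rfl fun i _ => ?_
  rw [mul_comm, polyProj_mul v _ (varSeq_mem i), mul_comm]

theorem exists_sum_of_ne_zero {v : ℤ} (hv : v ≠ 0) {f : MvPolynomial (Fin n) K}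
    (hf : f ∈ polyComp K n v) :
    ∃ c : ℕ → MvPolynomial (Fin n) K, (∀ i, c i ∈ polyComp K n (v - 1)) ∧
      f = ∑ i ∈ Finset.range n, varSeq K n i * c i := by
  refine exists_graded_sum hf ((mem_span_X_lt le_rfl).2 fun e he => ?_)
  by_contra! h
  have : e = 0 := Finsupp.ext fun i => h i i.2
  have h' := mem_polyComp.1 hf e he
  subst this
  simp at h'
  exact hv h'.symm

theorem mem_irrelevantIdeal {f : MvPolynomial (Fin n) K} :
    f ∈ irrelevantIdeal K n ↔
      ∃ c : ℕ → MvPolynomial (Fin n) K, f = ∑ i ∈ Finset.range n, varSeq K n i * c i := by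
  rw [mem_span_X_lt le_rfl, irrelevantIdeal, ← Set.image_univ, mem_ideal_span_X_image]
  simp

theorem mem_irrelevantIdeal_iff_coeff {f : MvPolynomial (Fin n) K} :
    f ∈ irrelevantIdeal K n ↔ coeff 0 f = 0 := by
  rw [irrelevantIdeal, ← Set.image_univ, mem_ideal_span_X_image]
  constructor
  · intro h
    by_contra h0
    obtain ⟨i, -, hi⟩ := h 0 (mem_support_iff.2 h0)
    simp at hi
  · intro h e he
    by_contra! h'
    have : e = 0 := Finsupp.ext fun i => h' i trivial
    subst this
    exact mem_support_iff.1 he h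

/-- The component of degree `v` of the graded free module with basis in degrees `deg`. -/
def freeComp {r : ℕ} (deg : Fin r → ℤ) (v : ℤ) : Submodule K (Fin r → MvPolynomial (Fin n) K) where
  carrier := {f | ∀ i, f i ∈ polyComp K n (v - deg i)}
  add_mem' ha hb i := add_mem (ha i) (hb i)
  zero_mem' _ := zero_mem _
  smul_mem' _ _ hf i := Submodule.smul_mem _ _ (hf i)

variable {r : ℕ} {deg : Fin r → ℤ}

/-- The homogeneous component of degree `v` of an element of a graded free module. -/
noncomputable def freeProj (deg : Fin r → ℤ) (v : ℤ) (f : Fin r → MvPolynomial (Fin n) K) :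
    Fin r → MvPolynomial (Fin n) K :=
  fun i => polyProj K n (v - deg i) (f i)

theorem freeProj_mem (v : ℤ) (f : Fin r → MvPolynomial (Fin n) K) :
    freeProj deg v f ∈ freeComp deg v := fun _ => polyProj_mem _ _

theorem freeProj_of_mem {v : ℤ} {f : Fin r → MvPolynomial (Fin n) K} (hf : f ∈ freeComp deg v) :
    freeProj deg v f = f := funext fun i => polyProj_of_mem (hf i)

theorem single_mem_freeComp (k : Fin r) :
    (Pi.single k 1 : Fin r → MvPolynomial (Fin n) K) ∈ freeComp deg (deg k) := by
  intro i
  by_cases h : i = k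
  · subst h
    rw [Pi.single_eq_same, sub_self]
    exact isHomogeneous_one _ _
  · rw [Pi.single_eq_of_ne h]
    exact zero_mem _

theorem map_freeProj {φ : (Fin r → MvPolynomial (Fin n) K) →ₗ[MvPolynomial (Fin n) K]
    MvPolynomial (Fin n) K} {e : ℤ}
    (hφ : ∀ k, φ (Pi.single k 1) ∈ polyComp K n (deg k - e)) (v : ℤ)
    (f : Fin r → MvPolynomial (Fin n) K) :
    φ (freeProj deg v f) = polyProj K n (v - e) (φ f) := by
  rw [LinearMap.pi_apply_eq_sum_univ φ f, LinearMap.pi_apply_eq_sum_univ φ, map_sum]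
  refine Finset.sum_congr rfl fun k _ => ?_
  have : (fun j => if k = j then (1 : MvPolynomial (Fin n) K) else 0) = Pi.single k 1 := by
    funext j; simp [Pi.single_apply, eq_comm]
  rw [this, smul_eq_mul, smul_eq_mul, polyProj_mul _ _ (hφ k)]
  rw [sub_sub_sub_cancel_right]
  rfl

theorem varSeq_smul_mem_freeComp (i : ℕ) (u : ℤ) (y : Fin r → MvPolynomial (Fin n) K)
    (hy : y ∈ freeComp deg u) : varSeq K n i • y ∈ freeComp deg (u + 1) := fun q => by
  have := mul_mem_polyComp (varSeq_mem i) (hy q)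
  rwa [show 1 + (u - deg q) = u + 1 - deg q by ring] at this

theorem exists_sum_freeComp {v : ℤ} {k : ℕ} {f : Fin r → MvPolynomial (Fin n) K}
    (hf : f ∈ freeComp deg v)
    (h : ∀ q, ∃ c : ℕ → MvPolynomial (Fin n) K,
      f q = ∑ i ∈ Finset.range k, varSeq K n i * c i) :
    ∃ c : ℕ → Fin r → MvPolynomial (Fin n) K, (∀ i, c i ∈ freeComp deg (v - 1)) ∧
      f = ∑ i ∈ Finset.range k, varSeq K n i • c i := by
  choose c hc hf' using fun q => exists_graded_sum (hf q) (h q)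
  refine ⟨fun i q => c q i, fun i q => ?_, ?_⟩
  · have := hc q i
    rwa [sub_right_comm] at this
  · funext q
    rw [hf' q]
    simp

/-- Multiplying by the `k`-th variable changes only the `k`-th exponent, so it cannot create
divisibility by an earlier variable. -/
theorem gradedRegular_freeComp :
    GradedRegular (varSeq K n) (freeComp (K := K) (n := n) deg) n := by
  intro k hk u b hb c h
  refine exists_sum_freeComp hb fun q => ?_
  have hq := (mem_span_X_lt hk.le).1 ⟨fun i => c i q, by simpa using congrFun h q⟩
  refine (mem_span_X_lt hk.le).2 fun e he => ?_
  obtain ⟨i, hi, h'⟩ := hq (e + Finsupp.single ⟨k, hk⟩ 1) (by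
    have : varSeq K n k = X ⟨k, hk⟩ := by simp [varSeq, hk]
    rw [this, mul_comm, coeff_mul_X]
    exact he)
  refine ⟨i, hi, ?_⟩
  have hne : (⟨k, hk⟩ : Fin n) ≠ i := fun h => by subst h; simp at hi
  simpa [Finsupp.single_apply, hne] using h'

end GradedPolynomials

/-! ### Koszul homology and the degrees of a minimal resolution -/

section Resolutions

open MvPolynomial

variable {K : Type*} [Field K] {n : ℕ}

theorem map_mem_polyComp {r : ℕ} {deg : Fin r → ℤ}
    {φ : (Fin r → MvPolynomial (Fin n) K) →ₗ[MvPolynomial (Fin n) K] MvPolynomial (Fin n) K}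
    {e : ℤ} (hφ : ∀ k, φ (Pi.single k 1) ∈ polyComp K n (deg k - e)) {v : ℤ}
    {f : Fin r → MvPolynomial (Fin n) K} (hf : f ∈ freeComp deg v) :
    φ f ∈ polyComp K n (v - e) := by
  rw [← freeProj_of_mem hf, map_freeProj hφ]
  exact polyProj_mem _ _

theorem map_freeProj_pi {r s : ℕ} {deg : Fin r → ℤ} {deg' : Fin s → ℤ}
    {φ : (Fin r → MvPolynomial (Fin n) K) →ₗ[MvPolynomial (Fin n) K]
      (Fin s → MvPolynomial (Fin n) K)}
    (hφ : ∀ k i, φ (Pi.single k 1) i ∈ polyComp K n (deg k - deg' i)) (v : ℤ)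
    (f : Fin r → MvPolynomial (Fin n) K) :
    φ (freeProj deg v f) = freeProj deg' v (φ f) :=
  funext fun i => map_freeProj (φ := LinearMap.proj i ∘ₗ φ) (fun k => hφ k i) v f

theorem map_freeComp_pi {r s : ℕ} {deg : Fin r → ℤ} {deg' : Fin s → ℤ}
    {φ : (Fin r → MvPolynomial (Fin n) K) →ₗ[MvPolynomial (Fin n) K]
      (Fin s → MvPolynomial (Fin n) K)}
    (hφ : ∀ k i, φ (Pi.single k 1) i ∈ polyComp K n (deg k - deg' i)) (v : ℤ) :
    (freeComp deg v).map (φ.restrictScalars K) =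
      freeComp deg' v ⊓ (LinearMap.range φ).restrictScalars K := by
  ext z
  constructor
  · rintro ⟨y, hy, rfl⟩
    refine ⟨?_, y, rfl⟩
    change φ y ∈ freeComp deg' v
    rw [← freeProj_of_mem hy, map_freeProj_pi hφ]
    exact freeProj_mem _ _
  · rintro ⟨hz, y, rfl⟩
    exact ⟨freeProj deg v y, freeProj_mem _ _, (map_freeProj_pi hφ v y).trans
      (freeProj_of_mem hz)⟩

variable {N : Type*} [AddCommGroup N] [Module K N] [Module (MvPolynomial (Fin n) K) N]
  [IsScalarTower K (MvPolynomial (Fin n) K) N]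

theorem exists_sum_of_mem_irrelevantIdeal {r : ℕ} {deg : Fin r → ℤ} {v : ℤ}
    {f : Fin r → MvPolynomial (Fin n) K} (hf : f ∈ freeComp deg v)
    (h : ∀ i, f i ∈ irrelevantIdeal K n) :
    ∃ c : ℕ → Fin r → MvPolynomial (Fin n) K, (∀ i, c i ∈ freeComp deg (v - 1)) ∧
      f = ∑ i ∈ Finset.range n, varSeq K n i • c i :=
  exists_sum_freeComp hf fun q => mem_irrelevantIdeal.1 (h q)

theorem hasKoszulHomology_succ_map_freeComp_iff {r : ℕ} {deg : Fin r → ℤ}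
    {p : (Fin r → MvPolynomial (Fin n) K) →ₗ[MvPolynomial (Fin n) K] N}
    (hp : ∀ y, p y = 0 → ∀ i, y i ∈ irrelevantIdeal K n) (j : ℕ) (v : ℤ) :
    HasKoszulHomology (varSeq K n) (fun u => (freeComp deg u).map (p.restrictScalars K)) n
        (j + 1) v ↔
      HasKoszulHomology (varSeq K n)
        (fun u => freeComp deg u ⊓ (LinearMap.ker p).restrictScalars K) n j v :=
  hasKoszulHomology_succ_map_iff varSeq_smul_mem_freeComp gradedRegular_freeComp p
    (fun _ y hy h => exists_sum_of_mem_irrelevantIdeal hy (hp y h)) j v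

/-- As the kernel lies in `𝔪F`, the map `F/𝔪F → p(F)/𝔪p(F)` is an isomorphism, and `F/𝔪F` lives
exactly in the degrees of the basis. -/
theorem hasKoszulHomology_zero_map_freeComp_iff {r : ℕ} {deg : Fin r → ℤ}
    {p : (Fin r → MvPolynomial (Fin n) K) →ₗ[MvPolynomial (Fin n) K] N}
    (hp : ∀ y, p y = 0 → ∀ i, y i ∈ irrelevantIdeal K n) (v : ℤ) :
    HasKoszulHomology (varSeq K n) (fun u => (freeComp deg u).map (p.restrictScalars K)) n 0 v ↔
      ∃ k, deg k = v := by
  rw [hasKoszulHomology_zero]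
  constructor
  · rintro ⟨_, ⟨y, hy, rfl⟩, h⟩
    by_contra! hk
    obtain ⟨c, hc, hcy⟩ := exists_sum_freeComp hy fun q => by
      obtain ⟨c, -, hc⟩ := exists_sum_of_ne_zero (sub_ne_zero.2 (hk q).symm) (hy q)
      exact ⟨c, hc⟩
    refine h (fun i => p (c i)) (fun i => ⟨c i, hc i, rfl⟩) ?_
    change p y = _
    rw [hcy, map_sum]
    simp
  · rintro ⟨k, rfl⟩
    refine ⟨p (Pi.single k 1), ⟨_, single_mem_freeComp k, rfl⟩, fun c hc h => ?_⟩
    choose f hf hfc using hc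
    have hfc : ∀ i, p (f i) = c i := hfc
    have h0 : p (Pi.single k 1 - ∑ i ∈ Finset.range n, varSeq K n i • f i) = 0 := by
      rw [map_sub, h, map_sum]
      simp [hfc]
    have h1 := hp _ h0 k
    have h2 : (∑ i ∈ Finset.range n, varSeq K n i • f i) k ∈ irrelevantIdeal K n :=
      mem_irrelevantIdeal.2 ⟨fun i => f i k, by simp⟩
    have h3 := add_mem h1 h2
    rw [Pi.sub_apply, sub_add_cancel, Pi.single_eq_same, mem_irrelevantIdeal_iff_coeff] at h3
    simp at h3

/-- The forms of degree `v` in an ideal. -/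
noncomputable def idealForms (J : Ideal (MvPolynomial (Fin n) K)) (v : ℤ) :
    Submodule K (MvPolynomial (Fin n) K) :=
  polyComp K n v ⊓ J.restrictScalars K

namespace MinimalGradedFreeResolution

variable {J : Ideal (MvPolynomial (Fin n) K)}

/-- The forms in the image of `F (j + 1) → F j`. -/
noncomputable def syzygyForms (F : MinimalGradedFreeResolution (n := n) (idealComp J)) (j : ℕ)
    (v : ℤ) :
    Submodule K (Fin (F.rank j) → MvPolynomial (Fin n) K) :=
  freeComp (F.deg j) v ⊓ (LinearMap.range (F.d j)).restrictScalars K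

variable (F : MinimalGradedFreeResolution (n := n) (idealComp J))

theorem map_aug (v : ℤ) :
    (freeComp (F.deg 0) v).map ((J.subtype ∘ₗ F.aug).restrictScalars K) = idealForms J v := by
  have hφ : ∀ k, (J.subtype ∘ₗ F.aug) (Pi.single k 1) ∈ polyComp K n (F.deg 0 k - 0) := fun k => by
    rw [sub_zero]
    exact F.aug_mem k
  ext z
  constructor
  · rintro ⟨y, hy, rfl⟩
    refine ⟨?_, (F.aug y).2⟩
    have := map_mem_polyComp hφ hy
    rwa [sub_zero] at this
  · rintro ⟨hz, hzJ⟩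
    obtain ⟨y, hy⟩ := F.aug_surjective ⟨z, hzJ⟩
    refine ⟨freeProj (F.deg 0) v y, freeProj_mem _ _, ?_⟩
    refine (map_freeProj hφ v y).trans ?_
    rw [sub_zero, LinearMap.comp_apply, hy]
    exact polyProj_of_mem hz

theorem map_d (j : ℕ) (v : ℤ) :
    (freeComp (F.deg (j + 1)) v).map ((F.d j).restrictScalars K) = F.syzygyForms j v :=
  map_freeComp_pi (F.d_mem j) v

theorem ker_d (j : ℕ) : LinearMap.ker (F.d j) = LinearMap.range (F.d (j + 1)) :=
  LinearMap.exact_iff.1 (F.exact_succ j)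

theorem ker_aug : LinearMap.ker F.aug = LinearMap.range (F.d 0) :=
  LinearMap.exact_iff.1 F.exact_zero

theorem ker_subtype_comp_aug :
    LinearMap.ker (J.subtype ∘ₗ F.aug) = LinearMap.range (F.d 0) := by
  rw [LinearMap.ker_comp, Submodule.ker_subtype, ← F.ker_aug]
  rfl

theorem mem_irrelevantIdeal_of_mem_range {j : ℕ} {y : Fin (F.rank j) → MvPolynomial (Fin n) K}
    (hy : y ∈ LinearMap.range (F.d j)) (i : Fin (F.rank j)) : y i ∈ irrelevantIdeal K n := by
  obtain ⟨w, rfl⟩ := hy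
  exact F.minimal j w i

/-- Each dimension shift trades one homological degree for the next syzygy module; after `i` shifts
only minimal generators remain to be counted. -/
theorem hasKoszulHomology_syzygyForms_iff (i j : ℕ) (v : ℤ) :
    HasKoszulHomology (varSeq K n) (F.syzygyForms j) n i v ↔
      ∃ k, F.deg (j + 1 + i) k = v := by
  have hp : ∀ j y, F.d j y = 0 → ∀ i, y i ∈ irrelevantIdeal K n := fun j y hy =>
    F.mem_irrelevantIdeal_of_mem_range (by rw [← F.ker_d]; exact hy)
  have hs : F.syzygyForms j =
      fun v => (freeComp (F.deg (j + 1)) v).map ((F.d j).restrictScalars K) :=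
    funext fun v => (F.map_d j v).symm
  induction i generalizing j with
  | zero => rw [hs, hasKoszulHomology_zero_map_freeComp_iff (hp j)]
  | succ i ih =>
    rw [hs, hasKoszulHomology_succ_map_freeComp_iff (hp j), F.ker_d]
    refine (ih (j + 1) (funext fun v => (F.map_d _ v).symm)).trans ?_
    rw [show j + 1 + 1 + i = j + 1 + (i + 1) by ring]

/-- The degrees of the basis of `F j` are those in which the Koszul homology does not vanish. -/
theorem hasKoszulHomology_iff (j : ℕ) (v : ℤ) :
    HasKoszulHomology (varSeq K n) (idealForms J) n j v ↔ ∃ k, F.deg j k = v := by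
  have hp : ∀ y, (J.subtype ∘ₗ F.aug) y = 0 → ∀ i, y i ∈ irrelevantIdeal K n := fun y hy =>
    F.mem_irrelevantIdeal_of_mem_range (by rw [← F.ker_subtype_comp_aug]; exact hy)
  have hs : idealForms J =
      fun v => (freeComp (F.deg 0) v).map ((J.subtype ∘ₗ F.aug).restrictScalars K) :=
    funext fun v => (F.map_aug v).symm
  cases j with
  | zero => rw [hs, hasKoszulHomology_zero_map_freeComp_iff hp]
  | succ j =>
    rw [hs, hasKoszulHomology_succ_map_freeComp_iff hp, F.ker_subtype_comp_aug]
    refine (F.hasKoszulHomology_syzygyForms_iff j 0 v).trans ?_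
    rw [show 0 + 1 + j = j + 1 by ring]

end MinimalGradedFreeResolution

end Resolutions

/-! ### Existence of minimal graded free resolutions -/

section Existence

open MvPolynomial

variable {K : Type*} [Field K] {n : ℕ}

theorem sum_freeProj {r : ℕ} (deg : Fin r → ℤ) (f : Fin r → MvPolynomial (Fin n) K) :
    ∃ S : Finset ℤ, f = ∑ v ∈ S, freeProj deg v f := by
  classical
  refine ⟨Finset.univ.biUnion fun i => (f i).support.image fun e => (e.degree : ℤ) + deg i, ?_⟩
  funext i
  ext e
  rw [Finset.sum_apply, coeff_sum]
  have : ∀ v, coeff e (freeProj deg v f i) =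
      if (e.degree : ℤ) + deg i = v then coeff e (f i) else 0 := fun v => by
    rw [freeProj, coeff_polyProj]
    simp only [eq_sub_iff_add_eq]
  simp only [this, Finset.sum_ite_eq]
  split_ifs with h
  · rfl
  · by_contra he
    exact h (Finset.mem_biUnion.2 ⟨i, Finset.mem_univ _, Finset.mem_image.2
      ⟨e, mem_support_iff.2 he, rfl⟩⟩)

/-- A submodule of a graded free module is homogeneous if it contains the homogeneous components
of its elements. -/
def IsHomogeneousSubmodule {r : ℕ} (deg : Fin r → ℤ)
    (N : Submodule (MvPolynomial (Fin n) K) (Fin r → MvPolynomial (Fin n) K)) : Prop :=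
  ∀ f ∈ N, ∀ v, freeProj deg v f ∈ N

theorem IsHomogeneousSubmodule.exists_generators {r : ℕ} {deg : Fin r → ℤ}
    {N : Submodule (MvPolynomial (Fin n) K) (Fin r → MvPolynomial (Fin n) K)}
    (hN : IsHomogeneousSubmodule deg N) :
    ∃ (s : ℕ) (g : Fin s → Fin r → MvPolynomial (Fin n) K) (deg' : Fin s → ℤ),
      (∀ k, g k ∈ freeComp deg (deg' k)) ∧ Submodule.span _ (Set.range g) = N := by
  have h1 : Submodule.span (MvPolynomial (Fin n) K) {f | f ∈ N ∧ ∃ v, f ∈ freeComp deg v} = N := by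
    apply le_antisymm
    · exact Submodule.span_le.2 fun f hf => hf.1
    · intro f hf
      obtain ⟨S, hS⟩ := sum_freeProj deg f
      rw [hS]
      exact sum_mem fun v _ => Submodule.subset_span ⟨hN f hf v, v, freeProj_mem _ _⟩
  obtain ⟨t, ht, htN⟩ := (Submodule.fg_span_iff_fg_span_finset_subset _).1
    (h1.symm ▸ IsNoetherian.noetherian N)
  rw [h1] at htN
  have hv : ∀ k : Fin t.card, ∃ v, ((t.equivFin.symm k : t) : Fin r → MvPolynomial (Fin n) K) ∈
    freeComp deg v := fun k => (ht (t.equivFin.symm k).2).2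
  choose deg' hdeg' using hv
  refine ⟨t.card, fun k => t.equivFin.symm k, deg', hdeg', ?_⟩
  rw [htN]
  congr 1
  ext f
  constructor
  · rintro ⟨k, rfl⟩
    exact (t.equivFin.symm k).2
  · intro hf
    exact ⟨t.equivFin ⟨f, hf⟩, by simp⟩

/-- Take the least possible number of homogeneous generators: a relation with a coefficient outside
`𝔪` would make one of them superfluous. -/
theorem IsHomogeneousSubmodule.exists_cover {r : ℕ} {deg : Fin r → ℤ}
    {N : Submodule (MvPolynomial (Fin n) K) (Fin r → MvPolynomial (Fin n) K)}
    (hN : IsHomogeneousSubmodule deg N) :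
    ∃ (s : ℕ) (deg' : Fin s → ℤ) (φ : (Fin s → MvPolynomial (Fin n) K) →ₗ[MvPolynomial (Fin n) K]
      (Fin r → MvPolynomial (Fin n) K)), LinearMap.range φ = N ∧
      (∀ k i, φ (Pi.single k 1) i ∈ polyComp K n (deg' k - deg i)) ∧
      ∀ y, φ y = 0 → ∀ i, y i ∈ irrelevantIdeal K n := by
  classical
  have hex := hN.exists_generators
  obtain ⟨g, deg', hg, hspan⟩ := Nat.find_spec hex
  have hmin := fun m hm => Nat.find_min hex (m := m) hm
  revert g deg' hmin
  generalize Nat.find hex = s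
  intro g deg' hg hspan hmin
  have hφ : ∀ k i, Fintype.linearCombination (MvPolynomial (Fin n) K) g (Pi.single k 1) i ∈
      polyComp K n (deg' k - deg i) := fun k i => by
    rw [Fintype.linearCombination_apply_single, one_smul]
    exact hg k i
  refine ⟨s, deg', Fintype.linearCombination _ g, ?_, hφ, ?_⟩
  · rw [Fintype.range_linearCombination, hspan]
  · intro y hy k
    by_contra hk
    rw [mem_irrelevantIdeal_iff_coeff] at hk
    -- In the component of degree `deg' k` of the relation, the coefficient of `g k` is its constant
    -- term, a unit, so `g k` can be eliminated.
    have h0 := map_freeProj_pi hφ (deg' k) y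
    rw [hy, show freeProj deg (deg' k) (0 : Fin r → MvPolynomial (Fin n) K) = 0 from
      freeProj_of_mem (zero_mem _), Fintype.linearCombination_apply] at h0
    cases s with
    | zero => exact k.elim0
    | succ s =>
      rw [Fin.sum_univ_succAbove _ k, freeProj, sub_self, coeff_zero_polyProj_zero] at h0
      refine hmin s (Nat.lt_succ_self s) ⟨g ∘ k.succAbove, deg' ∘ k.succAbove,
        fun i => hg _, ?_⟩
      rw [← hspan]
      apply le_antisymm
      · exact Submodule.span_mono (Set.range_comp_subset_range _ _)
      · rw [Submodule.span_le]
        rintro _ ⟨i, rfl⟩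
        rcases Fin.eq_self_or_eq_succAbove k i with rfl | ⟨i, rfl⟩
        · have h1 : g i = (C (coeff 0 (y i))⁻¹ : MvPolynomial (Fin n) K) •
              (C (coeff 0 (y i)) : MvPolynomial (Fin n) K) • g i := by
            rw [smul_smul, ← C_mul, inv_mul_cancel₀ hk, C_1, one_smul]
          rw [h1, eq_neg_of_add_eq_zero_left h0]
          refine Submodule.smul_mem _ _ (neg_mem (sum_mem fun j _ => Submodule.smul_mem _ _ ?_))
          exact Submodule.subset_span ⟨j, rfl⟩
        · exact Submodule.subset_span ⟨i, rfl⟩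

/-- A homogeneous submodule of `𝔪 F`, `F` a graded free module. -/
structure GradedSyzygy (K : Type*) [Field K] (n : ℕ) where
  /-- the rank of the free module -/
  rank : ℕ
  /-- the degrees of its basis -/
  deg : Fin rank → ℤ
  /-- the submodule -/
  N : Submodule (MvPolynomial (Fin n) K) (Fin rank → MvPolynomial (Fin n) K)
  homogeneous : IsHomogeneousSubmodule deg N
  le_irrelevant : ∀ y ∈ N, ∀ i, y i ∈ irrelevantIdeal K n

theorem IsHomogeneousSubmodule.exists_gradedSyzygy {r : ℕ} {deg : Fin r → ℤ}
    {N : Submodule (MvPolynomial (Fin n) K) (Fin r → MvPolynomial (Fin n) K)}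
    (hN : IsHomogeneousSubmodule deg N) :
    ∃ (S : GradedSyzygy K n) (φ : (Fin S.rank → MvPolynomial (Fin n) K)
      →ₗ[MvPolynomial (Fin n) K] (Fin r → MvPolynomial (Fin n) K)), LinearMap.range φ = N ∧
      (∀ k i, φ (Pi.single k 1) i ∈ polyComp K n (S.deg k - deg i)) ∧ LinearMap.ker φ = S.N := by
  obtain ⟨s, deg', φ, h1, h2, h3⟩ := hN.exists_cover
  refine ⟨⟨s, deg', LinearMap.ker φ, fun f hf v => ?_, h3⟩, φ, h1, h2, rfl⟩
  rw [LinearMap.mem_ker] at hf ⊢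
  rw [map_freeProj_pi h2, hf]
  exact freeProj_of_mem (zero_mem _)

/-- A homogeneous ideal has a minimal graded free resolution. -/
theorem nonempty_minimalGradedFreeResolution {J : Ideal (MvPolynomial (Fin n) K)}
    (hJ : ∀ f ∈ J, ∀ v, polyProj K n v f ∈ J) :
    Nonempty (MinimalGradedFreeResolution (n := n) (idealComp J)) := by
  -- The ideal is treated as a submodule of a free module of rank one, so that a single covering
  -- lemma serves every stage.
  have hN : IsHomogeneousSubmodule (fun _ : Fin 1 => (0 : ℤ))
      (Submodule.comap (LinearMap.proj 0 : (Fin 1 → MvPolynomial (Fin n) K)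
        →ₗ[MvPolynomial (Fin n) K] MvPolynomial (Fin n) K) J) := by
    intro f hf v
    have := hJ (f 0) hf v
    rw [← sub_zero v] at this
    exact this
  obtain ⟨S₀, φ, hr, hh, hk⟩ := hN.exists_gradedSyzygy
  choose next d hr' hh' hk' using fun S : GradedSyzygy K n => S.homogeneous.exists_gradedSyzygy
  let S : ℕ → GradedSyzygy K n := fun j => Nat.rec S₀ (fun _ T => next T) j
  have haug : ∀ y, LinearMap.proj 0 (φ y) ∈ J := fun y => by
    have : φ y ∈ LinearMap.range φ := ⟨y, rfl⟩
    rw [hr] at this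
    exact this
  refine ⟨{ rank := fun j => (S j).rank
            deg := fun j => (S j).deg
            d := fun j => d (S j)
            aug := (LinearMap.proj 0 ∘ₗ φ).codRestrict J haug
            aug_surjective := ?_
            exact_zero := ?_
            exact_succ := ?_
            aug_mem := ?_
            d_mem := fun j => hh' (S j)
            minimal := ?_ }⟩
  · rintro ⟨f, hf⟩
    have : (fun _ => f : Fin 1 → MvPolynomial (Fin n) K) ∈ LinearMap.range φ := by
      rw [hr]
      exact hf
    obtain ⟨y, hy⟩ := this
    exact ⟨y, Subtype.ext (congrFun hy 0)⟩
  · rw [LinearMap.exact_iff, LinearMap.ker_codRestrict]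
    refine Eq.trans ?_ (hk.trans (hr' S₀).symm)
    ext y
    rw [LinearMap.mem_ker, LinearMap.mem_ker]
    constructor
    · intro h
      funext i
      rw [Subsingleton.elim i 0]
      exact h
    · intro h
      exact congrFun h 0
  · intro j
    rw [LinearMap.exact_iff]
    exact (hk' (S j)).trans (hr' (S (j + 1))).symm
  · intro k
    have := hh k 0
    rw [sub_zero] at this
    exact this
  · intro j x i
    exact (S j).le_irrelevant _ (by rw [← hr']; exact ⟨x, rfl⟩) i

end Existence

/-! ### Projective dimension as the length of a minimal resolution -/

section ProjectiveDimension

open MvPolynomial CategoryTheory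

universe u

variable {K : Type u} [Field K] {n : ℕ}

/-- A section `s` of `p` gives `y = ∑ yᵢ (eᵢ - s (p eᵢ))` on the kernel, so the kernel equals `𝔪`
times itself. Nakayama then yields an annihilator congruent to `1` modulo `𝔪`, which is nonzero, and
a free module over a domain is torsion-free. -/
theorem ker_eq_bot_of_projective {M : Type*} [AddCommGroup M] [Module (MvPolynomial (Fin n) K) M]
    [Module.Projective (MvPolynomial (Fin n) K) M] {r : ℕ}
    {p : (Fin r → MvPolynomial (Fin n) K) →ₗ[MvPolynomial (Fin n) K] M}
    (hp : Function.Surjective p) (hm : ∀ y, p y = 0 → ∀ i, y i ∈ irrelevantIdeal K n) :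
    LinearMap.ker p = ⊥ := by
  obtain ⟨s, hs⟩ := Module.projective_lifting_property p LinearMap.id hp
  have hs' : ∀ y, p (s y) = y := fun y => LinearMap.congr_fun hs y
  have hle : LinearMap.ker p ≤ irrelevantIdeal K n • LinearMap.ker p := by
    intro y hy
    have hy' : p y = 0 := hy
    have h1 : y = ∑ i, y i • (Pi.single i (1 : MvPolynomial (Fin n) K) -
        s (p (Pi.single i 1))) := by
      have h2 : ∑ i, y i • (Pi.single i (1 : MvPolynomial (Fin n) K) :
          Fin r → MvPolynomial (Fin n) K) = y := by
        funext q
        simp [Finset.sum_apply, Pi.single_apply]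
      simp only [smul_sub, Finset.sum_sub_distrib, ← map_smul]
      rw [← map_sum, ← map_sum, h2, hy', map_zero, sub_zero]
    rw [h1]
    refine sum_mem fun i _ => Submodule.smul_mem_smul (hm y hy' i) ?_
    rw [LinearMap.mem_ker, map_sub, hs', sub_self]
  obtain ⟨r, hr, h0⟩ := Submodule.exists_sub_one_mem_and_smul_eq_zero_of_fg_of_le_smul
    _ _ (IsNoetherian.noetherian _) hle
  have hr0 : r ≠ 0 := by
    rintro rfl
    rw [mem_irrelevantIdeal_iff_coeff] at hr
    simp at hr
  rw [eq_bot_iff]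
  intro y hy
  have := h0 y hy
  funext q
  have hq := congrFun this q
  exact (mul_eq_zero.1 hq).resolve_left hr0

theorem hasProjectiveDimensionLT_one_iff {M : Type u} [AddCommGroup M]
    [Module (MvPolynomial (Fin n) K) M] {r : ℕ}
    {p : (Fin r → MvPolynomial (Fin n) K) →ₗ[MvPolynomial (Fin n) K] M}
    (hp : Function.Surjective p) (hm : ∀ y, p y = 0 → ∀ i, y i ∈ irrelevantIdeal K n) :
    HasProjectiveDimensionLT (ModuleCat.of (MvPolynomial (Fin n) K) M) 1 ↔
      LinearMap.ker p = ⊥ := by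
  rw [← projective_iff_hasProjectiveDimensionLT_one, ← IsProjective.iff_projective]
  constructor
  · intro h
    exact ker_eq_bot_of_projective hp hm
  · intro h
    exact Module.Projective.of_equiv (LinearEquiv.ofBijective p ⟨LinearMap.ker_eq_bot.1 h, hp⟩)

theorem hasProjectiveDimensionLT_succ_iff {M : Type u} [AddCommGroup M]
    [Module (MvPolynomial (Fin n) K) M] {r : ℕ}
    {p : (Fin r → MvPolynomial (Fin n) K) →ₗ[MvPolynomial (Fin n) K] M}
    (hp : Function.Surjective p) (i : ℕ) :
    HasProjectiveDimensionLT (ModuleCat.of (MvPolynomial (Fin n) K) M) (i + 2) ↔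
      HasProjectiveDimensionLT (ModuleCat.of (MvPolynomial (Fin n) K) (LinearMap.ker p))
        (i + 1) := by
  have hS := LinearMap.shortExact_shortComplexKer hp
  exact hS.hasProjectiveDimensionLT_X₃_iff i
    (inferInstanceAs (Projective (ModuleCat.of (MvPolynomial (Fin n) K)
      (Fin r → MvPolynomial (Fin n) K))))

namespace MinimalGradedFreeResolution

variable {J : Ideal (MvPolynomial (Fin n) K)}
  (F : MinimalGradedFreeResolution (n := n) (idealComp J))

theorem rank_eq_zero_of_range {j : ℕ} (h : LinearMap.range (F.d j) = ⊤) : F.rank j = 0 := by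
  by_contra h0
  let k : Fin (F.rank j) := ⟨0, Nat.pos_of_ne_zero h0⟩
  have := F.mem_irrelevantIdeal_of_mem_range (y := Pi.single k 1) (by rw [h]; trivial) k
  rw [Pi.single_eq_same, mem_irrelevantIdeal_iff_coeff] at this
  simp at this

theorem rank_succ_eq_zero_iff {j : ℕ} :
    F.rank (j + 1) = 0 ↔ LinearMap.range (F.d j) = ⊥ := by
  constructor
  · intro h
    have : IsEmpty (Fin (F.rank (j + 1))) := by rw [h]; infer_instance
    rw [eq_bot_iff]
    rintro _ ⟨y, rfl⟩
    rw [Subsingleton.elim y 0, map_zero]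
    exact zero_mem _
  · intro h
    refine F.rank_eq_zero_of_range ?_
    rw [← F.ker_d, LinearMap.ker_eq_top]
    exact LinearMap.range_eq_bot.1 h

theorem rank_succ_eq_zero {j : ℕ} (h : F.rank j = 0) : F.rank (j + 1) = 0 := by
  have : IsEmpty (Fin (F.rank j)) := by rw [h]; infer_instance
  exact F.rank_succ_eq_zero_iff.2 (Subsingleton.elim _ _)

theorem rank_ne_zero_of_le {i j : ℕ} (hij : i ≤ j) (h : F.rank j ≠ 0) : F.rank i ≠ 0 := by
  induction j, hij using Nat.le_induction with
  | base => exact h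
  | succ j _ ih => exact ih fun h' => h (F.rank_succ_eq_zero h')

theorem hasProjectiveDimensionLT_range_iff (i j : ℕ) :
    HasProjectiveDimensionLT (ModuleCat.of (MvPolynomial (Fin n) K) (LinearMap.range (F.d j)))
      (i + 1) ↔ F.rank (j + 1 + i + 1) = 0 := by
  have hker : ∀ j, LinearMap.ker (F.d j).rangeRestrict = LinearMap.range (F.d (j + 1)) :=
    fun j => by rw [LinearMap.ker_rangeRestrict, F.ker_d]
  induction i generalizing j with
  | zero =>
    rw [hasProjectiveDimensionLT_one_iff (F.d j).surjective_rangeRestrict, hker,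
      rank_succ_eq_zero_iff]
    intro y hy
    exact F.mem_irrelevantIdeal_of_mem_range (by rw [← hker]; exact hy)
  | succ i ih =>
    rw [hasProjectiveDimensionLT_succ_iff (F.d j).surjective_rangeRestrict, hker]
    refine (ih (j + 1)).trans ?_
    rw [show j + 1 + 1 + i + 1 = j + 1 + (i + 1) + 1 by ring]

theorem hasProjectiveDimensionLT_iff (i : ℕ) :
    HasProjectiveDimensionLT (ModuleCat.of (MvPolynomial (Fin n) K) J) (i + 1) ↔
      F.rank (i + 1) = 0 := by
  cases i with
  | zero =>
    rw [hasProjectiveDimensionLT_one_iff F.aug_surjective, F.ker_aug, rank_succ_eq_zero_iff]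
    intro y hy
    exact F.mem_irrelevantIdeal_of_mem_range (by rw [← F.ker_aug]; exact hy)
  | succ i =>
    rw [hasProjectiveDimensionLT_succ_iff F.aug_surjective, F.ker_aug,
      hasProjectiveDimensionLT_range_iff, show 0 + 1 + i + 1 = i + 1 + 1 by ring]

theorem projectiveDimension_eq {p : ℕ} (h : F.rank p ≠ 0) (h' : F.rank (p + 1) = 0) :
    projectiveDimension (ModuleCat.of (MvPolynomial (Fin n) K) J) = p := by
  apply le_antisymm
  · rw [projectiveDimension_le_iff]
    exact (F.hasProjectiveDimensionLT_iff p).2 h'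
  · rw [projectiveDimension_ge_iff]
    cases p with
    | zero =>
      -- The zero module has projective dimension `⊥`, not `0`, so the case `p = 0` needs `J` to be
      -- nonzero.
      rw [hasProjectiveDimensionLT_zero_iff_isZero, ModuleCat.isZero_iff_subsingleton]
      intro (hJ : Subsingleton J)
      refine h (F.rank_eq_zero_of_range ?_)
      rw [← F.ker_aug, LinearMap.ker_eq_top]
      exact LinearMap.ext fun _ => Subsingleton.elim _ _
    | succ p => rwa [F.hasProjectiveDimensionLT_iff]

end MinimalGradedFreeResolution

end ProjectiveDimension

/-! ### Finite generation over the multi-Rees algebra -/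

section MultiRees

open MvPolynomial

variable {ι A : Type*} [Fintype ι] [CommRing A]

theorem prod_pow_add (I : ι → Ideal A) (a b : ι → ℕ) :
    ∏ i, I i ^ (a + b) i = (∏ i, I i ^ a i) * ∏ i, I i ^ b i := by
  rw [← Finset.prod_mul_distrib]
  exact Finset.prod_congr rfl fun i _ => pow_add _ _ _

/-- The multi-Rees algebra `⨁ₐ I₁^{a₁} ⋯ I_m^{a_m} t^a`. -/
def multiRees (I : ι → Ideal A) : Subalgebra A (MvPolynomial ι A) where
  carrier := {f | ∀ e, coeff e f ∈ ∏ i, I i ^ e i}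
  mul_mem' {f g} hf hg e := by
    classical
    rw [coeff_mul]
    refine sum_mem fun ⟨a, b⟩ hab => ?_
    replace hab : a + b = e := Finset.HasAntidiagonal.mem_antidiagonal.1 hab
    rw [← hab, Finsupp.coe_add, prod_pow_add]
    exact Ideal.mul_mem_mul (hf a) (hg b)
  add_mem' {f g} hf hg e := by
    rw [coeff_add]
    exact add_mem (hf e) (hg e)
  algebraMap_mem' r e := by
    classical
    rw [algebraMap_eq, coeff_C]
    split_ifs with h
    · subst h
      have h1 : ∏ i, I i ^ (0 : ι →₀ ℕ) i = 1 := Finset.prod_eq_one fun i _ => pow_zero _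
      rw [h1, Ideal.one_eq_top]
      trivial
    · exact zero_mem _

theorem monomial_mem_multiRees {I : ι → Ideal A} {e : ι →₀ ℕ} {r : A} (hr : r ∈ ∏ i, I i ^ e i) :
    monomial e r ∈ multiRees I := fun e' => by
  classical
  rw [coeff_monomial]
  split_ifs with h
  · subst h
    exact hr
  · exact zero_mem _

/-- The ideals `J e` of all `r` with `r t^e ∈ S` satisfy `J a * J b ≤ J (a + b)`, so containments
for the individual `I i` multiply up. -/
theorem prod_pow_le_comap_monomial {I : ι → Ideal A} {S : Subalgebra A (MvPolynomial ι A)}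
    (hS : ∀ i, ∀ r ∈ I i, monomial (Finsupp.single i 1) r ∈ S) (e : ι →₀ ℕ) :
    ∏ i, I i ^ e i ≤ (Subalgebra.toSubmodule S).comap (monomial e) := by
  classical
  let J : (ι →₀ ℕ) → Ideal A := fun e => (Subalgebra.toSubmodule S).comap (monomial e)
  have hmul : ∀ a b, J a * J b ≤ J (a + b) := fun a b => by
    rw [Ideal.mul_le]
    intro r hr s hs
    change monomial (a + b) (r * s) ∈ S
    rw [← monomial_mul]
    exact mul_mem hr hs
  have hone : 1 ≤ J 0 := by
    rintro r -
    change monomial 0 r ∈ S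
    exact S.algebraMap_mem r
  have hpow : ∀ i k, I i ^ k ≤ J (Finsupp.single i k) := fun i k => by
    induction k with
    | zero => simpa using hone
    | succ k ih =>
      rw [pow_succ, Finsupp.single_add]
      exact (Ideal.mul_mono ih fun r hr => hS i r hr).trans (hmul _ _)
  have hprod : ∀ s : Finset ι, ∏ i ∈ s, I i ^ e i ≤ J (∑ i ∈ s, Finsupp.single i (e i)) :=
    fun s => by
      induction s using Finset.induction_on with
      | empty => simpa using hone
      | insert i s hi ih =>
        rw [Finset.prod_insert hi, Finset.sum_insert hi]
        exact (Ideal.mul_mono (hpow i _) ih).trans (hmul _ _)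
  have := hprod Finset.univ
  rwa [Finsupp.univ_sum_single] at this

theorem multiRees_fg [IsNoetherianRing A] (I : ι → Ideal A) : (multiRees I).FG := by
  classical
  choose s hs using fun i => (IsNoetherian.noetherian (I i) : (I i).FG)
  refine Subalgebra.fg_def.2 ⟨⋃ i, monomial (Finsupp.single i 1) '' (s i : Set A),
    Set.finite_iUnion fun i => (s i).finite_toSet.image _, le_antisymm ?_ ?_⟩
  · rw [Algebra.adjoin_le_iff]
    rintro f hf
    obtain ⟨i, r, hr, rfl⟩ := Set.mem_iUnion.1 hf
    refine monomial_mem_multiRees ?_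
    rw [Finset.prod_eq_single_of_mem i (Finset.mem_univ i) fun j _ hj => by
      simp [Finsupp.single_eq_of_ne hj]]
    rw [Finsupp.single_eq_same, pow_one, ← hs i]
    exact Ideal.subset_span hr
  · intro f hf
    rw [← support_sum_monomial_coeff f]
    refine sum_mem fun e _ => ?_
    refine (prod_pow_le_comap_monomial (I := I) (S := Algebra.adjoin A _) ?_ e) (hf e)
    intro i
    change I i ≤ (Subalgebra.toSubmodule (Algebra.adjoin A _)).comap
      (monomial (Finsupp.single i 1))
    rw [← hs i, Submodule.span_le]
    intro r hr
    exact Algebra.subset_adjoin (Set.mem_iUnion.2 ⟨i, r, hr, rfl⟩)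

instance [IsNoetherianRing A] (I : ι → Ideal A) : IsNoetherianRing (multiRees I) :=
  have : Algebra.FiniteType A (multiRees I) := ⟨(multiRees I).fg_top.2 (multiRees_fg I)⟩
  Algebra.FiniteType.isNoetherianRing A _

/-- Any family of vectors over the products of powers of ideals is generated, with coefficients in
products of powers of these ideals, by finitely many of its members. -/
theorem exists_finset_generators [IsNoetherianRing A] (I : ι → Ideal A) {Q : Type*} [Finite Q]
    (G : Set ((ι → ℕ) × (Q → A))) (hG : ∀ g ∈ G, ∀ q, g.2 q ∈ ∏ i, I i ^ g.1 i) :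
    ∃ t : Finset ((ι → ℕ) × (Q → A)), ↑t ⊆ G ∧ ∀ g ∈ G, ∃ f : (ι → ℕ) × (Q → A) → A,
      (∀ s, s.1 ≤ g.1 → f s ∈ ∏ i, I i ^ (g.1 - s.1) i) ∧ g.2 = ∑ s ∈ t, f s • s.2 := by
  classical
  let E : (ι → ℕ) → ι →₀ ℕ := Finsupp.equivFunOnFinite.symm
  -- A vector over `I^a` becomes a vector of monomials `r t^a`, so that all exponents `a` live in
  -- one finite module over a Noetherian ring.
  let V : G → Q → multiRees I := fun g q =>
    ⟨monomial (E g.1.1) (g.1.2 q), monomial_mem_multiRees (hG g.1 g.2 q)⟩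
  obtain ⟨t', ht', htV⟩ := (Submodule.fg_span_iff_fg_span_finset_subset (R := multiRees I)
    (Set.range V)).1 (IsNoetherian.noetherian _)
  rw [← Set.image_univ] at ht'
  obtain ⟨t, -, rfl⟩ := Finset.subset_set_image_iff.1 ht'
  refine ⟨t.image Subtype.val, by simp, fun g hg => ?_⟩
  have hmem : V ⟨g, hg⟩ ∈ Submodule.span (multiRees I) (V '' t) := by
    rw [← Finset.coe_image, ← htV]
    exact Submodule.subset_span ⟨_, rfl⟩
  obtain ⟨c, hc⟩ := (Submodule.mem_span_image_finset_iff_exists_fun _).1 hmem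
  let c₀ : G → multiRees I := fun s => if h : s ∈ t then c ⟨s, h⟩ else 0
  have hc : ∑ s ∈ t, c₀ s • V s = V ⟨g, hg⟩ := by
    rw [← hc, ← Finset.sum_coe_sort t]
    exact Finset.sum_congr rfl fun s _ => by simp [c₀]
  let c' : (ι → ℕ) × (Q → A) → MvPolynomial ι A := fun s =>
    if h : s ∈ G then (c₀ ⟨s, h⟩ : MvPolynomial ι A) else 0
  have hc' : ∀ s, c' s ∈ multiRees I := fun s => by
    dsimp only [c']
    split_ifs
    · exact (c₀ _).2
    · exact zero_mem _
  -- Comparing coefficients of `t^(g.1)`: the member `s` contributes only the coefficient of `t^(g.1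
  -- - s.1)` of its multiplier, and nothing unless `s.1 ≤ g.1`.
  refine ⟨fun s => if s.1 ≤ g.1 then coeff (E g.1 - E s.1) (c' s) else 0, fun s hs => ?_, ?_⟩
  · simp only [if_pos hs]
    exact hc' s (E g.1 - E s.1)
  · funext q
    have hq := congrArg (fun z : Q → multiRees I => coeff (E g.1) (z q : MvPolynomial ι A)) hc
    simp only [Finset.sum_apply] at hq
    rw [AddSubmonoidClass.coe_finsetSum, coeff_sum] at hq
    have h1 : coeff (E g.1) (V ⟨g, hg⟩ q : MvPolynomial ι A) = g.2 q := by
      simp [V]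
    rw [h1] at hq
    rw [← hq, Finset.sum_apply, Finset.sum_image fun _ _ _ _ h => Subtype.ext h]
    refine Finset.sum_congr rfl fun s _ => ?_
    change coeff (E g.1) ((c₀ s : MvPolynomial ι A) * monomial (E s.1.1) (s.1.2 q)) = _
    rw [coeff_mul_monomial']
    have h2 : c' s.1 = c₀ s := by simp [c']
    change _ = (if s.1.1 ≤ g.1 then coeff (E g.1 - E s.1.1) (c' s.1) else 0) * s.1.2 q
    rw [h2, ite_mul, zero_mul]
    have h3 : E s.1.1 ≤ E g.1 ↔ s.1.1 ≤ g.1 := Iff.rfl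
    simp only [h3]

end MultiRees

/-! ### Stabilization of the Koszul degrees of `I^a` -/

section Asymptotics

open MvPolynomial
open scoped Pointwise

variable {K : Type*} [Field K] {n : ℕ}

theorem mem_span_mul_of_mem_span {S : Set (MvPolynomial (Fin n) K)} {D : ℕ}
    (hS : ∀ s ∈ S, s.IsHomogeneous D) {f : MvPolynomial (Fin n) K} (hf : f ∈ Ideal.span S) (v : ℤ) :
    polyProj K n v f ∈
      Submodule.span K {h | ∃ g ∈ polyComp K n (v - D), ∃ s ∈ S, h = g * s} := by
  suffices ∀ r, polyProj K n v (r * f) ∈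
      Submodule.span K {h | ∃ g ∈ polyComp K n (v - D), ∃ s ∈ S, h = g * s} by
    simpa using this 1
  refine Submodule.span_induction ?_ ?_ ?_ ?_ hf
  · intro s hs r
    rw [polyProj_mul _ _ (isHomogeneous_iff_mem_polyComp.1 (hS s hs))]
    exact Submodule.subset_span ⟨_, polyProj_mem _ _, s, hs, rfl⟩
  · intro r
    rw [mul_zero, map_zero]
    exact zero_mem _
  · intro f g _ _ hf hg r
    rw [mul_add, map_add]
    exact add_mem (hf r) (hg r)
  · intro a f _ hf r
    rw [smul_eq_mul, ← mul_assoc]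
    exact hf (r * a)

namespace GeneratedInDegree

theorem one : GeneratedInDegree (1 : Ideal (MvPolynomial (Fin n) K)) 0 :=
  ⟨{1}, by simpa using isHomogeneous_one (Fin n) K, by
    rw [Ideal.span_singleton_one, Ideal.one_eq_top]⟩

theorem mul {I J : Ideal (MvPolynomial (Fin n) K)} {d e : ℕ} (hI : GeneratedInDegree I d)
    (hJ : GeneratedInDegree J e) : GeneratedInDegree (I * J) (d + e) := by
  obtain ⟨S, hS, rfl⟩ := hI
  obtain ⟨T, hT, rfl⟩ := hJ
  refine ⟨S * T, ?_, Ideal.span_mul_span' S T⟩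
  rintro _ ⟨s, hs, t, ht, rfl⟩
  exact (hS s hs).mul (hT t ht)

theorem pow {I : Ideal (MvPolynomial (Fin n) K)} {d : ℕ} (hI : GeneratedInDegree I d) (k : ℕ) :
    GeneratedInDegree (I ^ k) (d * k) := by
  induction k with
  | zero => exact one
  | succ k ih => exact ih.mul hI

theorem prod {ι : Type*} {I : ι → Ideal (MvPolynomial (Fin n) K)} {d : ι → ℕ}
    (hI : ∀ i, GeneratedInDegree (I i) (d i)) (s : Finset ι) :
    GeneratedInDegree (∏ i ∈ s, I i) (∑ i ∈ s, d i) := by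
  classical
  induction s using Finset.induction_on with
  | empty => exact one
  | insert i s hi ih =>
    rw [Finset.prod_insert hi, Finset.sum_insert hi]
    exact (hI i).mul ih

theorem prodPow {m : ℕ} {I : Fin m → Ideal (MvPolynomial (Fin n) K)} {d : Fin m → ℕ}
    (hI : ∀ i, GeneratedInDegree (I i) (d i)) (a : Fin m → ℕ) :
    GeneratedInDegree (prodPow I a) (∑ i, d i * a i) :=
  prod (fun i => (hI i).pow (a i)) Finset.univ

variable {J J' : Ideal (MvPolynomial (Fin n) K)} {D D' : ℕ}

theorem polyProj_mem (hJ : GeneratedInDegree J D) (f : MvPolynomial (Fin n) K) (hf : f ∈ J)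
    (v : ℤ) : polyProj K n v f ∈ J := by
  obtain ⟨S, hS, rfl⟩ := hJ
  have := mem_span_mul_of_mem_span hS hf v
  rw [← Submodule.restrictScalars_mem K]
  refine Submodule.span_le.2 ?_ this
  rintro _ ⟨g, -, s, hs, rfl⟩
  exact Ideal.mul_mem_left _ _ (Ideal.subset_span hs)

theorem eq_zero_of_lt (hJ : GeneratedInDegree J D) {v : ℤ} (hv : v < D)
    {f : MvPolynomial (Fin n) K} (hf : f ∈ idealForms J v) : f = 0 := by
  obtain ⟨S, hS, rfl⟩ := hJ
  have := mem_span_mul_of_mem_span hS hf.2 v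
  rw [polyProj_of_mem hf.1] at this
  rw [← Submodule.mem_bot K]
  refine Submodule.span_le.2 ?_ this
  rintro _ ⟨g, hg, s, hs, rfl⟩
  rw [polyComp_eq_bot (by omega) hg, zero_mul]
  rfl

/-- Above the generating degree every form of `J` lies in `𝔪J`, so multiplication by it is zero on
Koszul homology. -/
theorem exists_sum_of_gt (hJ : GeneratedInDegree J D) {v : ℤ} (hv : (D : ℤ) < v)
    {f : MvPolynomial (Fin n) K} (hf : f ∈ idealForms J v) :
    ∃ c : ℕ → MvPolynomial (Fin n) K, (∀ i, c i ∈ idealForms J (v - 1)) ∧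
      f = ∑ i ∈ Finset.range n, varSeq K n i * c i := by
  obtain ⟨S, hS, rfl⟩ := hJ
  have := mem_span_mul_of_mem_span hS hf.2 v
  rw [polyProj_of_mem hf.1] at this
  refine Submodule.span_induction ?_ ?_ ?_ ?_ this
  · rintro _ ⟨g, hg, s, hs, rfl⟩
    obtain ⟨c, hc, rfl⟩ := exists_sum_of_ne_zero (by omega) hg
    refine ⟨fun i => c i * s, fun i => ⟨?_, ?_⟩, ?_⟩
    · have := mul_mem_polyComp (hc i) (isHomogeneous_iff_mem_polyComp.1 (hS s hs))
      rwa [show v - D - 1 + D = v - 1 by ring] at this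
    · exact Ideal.mul_mem_left _ _ (Ideal.subset_span hs)
    · rw [Finset.sum_mul]
      exact Finset.sum_congr rfl fun i _ => mul_assoc _ _ _
  · exact ⟨0, fun i => zero_mem _, by simp⟩
  · rintro _ _ - - ⟨c, hc, rfl⟩ ⟨c', hc', rfl⟩
    exact ⟨c + c', fun i => add_mem (hc i) (hc' i), by simp [mul_add, Finset.sum_add_distrib]⟩
  · rintro a _ - ⟨c, hc, rfl⟩
    exact ⟨a • c, fun i => Submodule.smul_mem _ a (hc i), by simp [Finset.smul_sum]⟩

/-- In the least degree forms of a product split into products of least-degree forms; thus whatever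
is killed by those of `J'` is killed by those of `J * J'`. -/
theorem mem_span_mul (hJ : GeneratedInDegree J D) (hJ' : GeneratedInDegree J' D')
    {v : ℤ} (hv : v = D + D') {f : MvPolynomial (Fin n) K} (hf : f ∈ idealForms (J * J') v) :
    f ∈ Submodule.span K {h | ∃ g ∈ idealForms J D, ∃ g' ∈ idealForms J' D', h = g * g'} := by
  obtain ⟨S, hS, rfl⟩ := hJ
  obtain ⟨S', hS', rfl⟩ := hJ'
  have hST : ∀ s ∈ S * S', s.IsHomogeneous (D + D') := by
    rintro _ ⟨s, hs, t, ht, rfl⟩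
    exact (hS s hs).mul (hS' t ht)
  have := mem_span_mul_of_mem_span hST (by rw [← Ideal.span_mul_span']; exact hf.2) v
  rw [polyProj_of_mem hf.1] at this
  refine Submodule.span_mono ?_ this
  rintro _ ⟨g, hg, _, ⟨s, hs, s', hs', rfl⟩, rfl⟩
  refine ⟨g * s, ⟨?_, Ideal.mul_mem_left _ _ (Ideal.subset_span hs)⟩, s',
    ⟨hS' s' hs', Ideal.subset_span hs'⟩, (mul_assoc _ _ _).symm⟩
  have := mul_mem_polyComp hg (isHomogeneous_iff_mem_polyComp.1 (hS s hs))
  rwa [show v - (D + D' : ℕ) + D = D by push_cast; omega] at this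

end GeneratedInDegree

variable {J J' : Ideal (MvPolynomial (Fin n) K)}

theorem mul_mem_idealForms {u v : ℤ} {f g : MvPolynomial (Fin n) K} (hf : f ∈ idealForms J u)
    (hg : g ∈ idealForms J' v) : f * g ∈ idealForms (J * J') (u + v) :=
  ⟨mul_mem_polyComp hf.1 hg.1, Ideal.mul_mem_mul hf.2 hg.2⟩

theorem smul_mem_koszulStrand {k j : ℕ} {u v : ℤ} {f : MvPolynomial (Fin n) K}
    (hf : f ∈ idealForms J u) {z : KoszulIndex k → MvPolynomial (Fin n) K}
    (hz : z ∈ koszulStrand (idealForms J') k j v) :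
    f • z ∈ koszulStrand (idealForms (J * J')) k j (u + v) := fun q =>
  ⟨mul_mem_idealForms hf (hz q).1, fun hq => by simp [(hz q).2 hq]⟩

theorem smul_mem_koszulBoundary_idealForms {k j : ℕ} {u v : ℤ} {f : MvPolynomial (Fin n) K}
    (hf : f ∈ idealForms J u) {z : KoszulIndex k → MvPolynomial (Fin n) K}
    (hz : z ∈ koszulBoundary (varSeq K n) (idealForms J') k j v) :
    f • z ∈ koszulBoundary (varSeq K n) (idealForms (J * J')) k j (u + v) := by
  obtain ⟨w, hw, rfl⟩ := hz
  exact ⟨f • w, smul_mem_koszulStrand hf hw, map_smul (koszulD _ _ _) _ _⟩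

theorem prodPow_add {m : ℕ} (I : Fin m → Ideal (MvPolynomial (Fin n) K)) (a b : Fin m → ℕ) :
    prodPow I (a + b) = prodPow I a * prodPow I b := prod_pow_add I a b

/-- The degree `d₁ a₁ + ⋯ + d_m a_m`. -/
def dotDegree {m : ℕ} (d a : Fin m → ℕ) : ℤ := ∑ i, (d i : ℤ) * (a i : ℤ)

theorem dotDegree_add {m : ℕ} (d a b : Fin m → ℕ) :
    dotDegree d (a + b) = dotDegree d a + dotDegree d b := by
  simp [dotDegree, mul_add, Finset.sum_add_distrib]

theorem natCast_sum_mul {m : ℕ} (d a : Fin m → ℕ) :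
    ((∑ i, d i * a i : ℕ) : ℤ) = dotDegree d a := by
  simp [dotDegree]

/-- The shifted degrees in which the Koszul homology of `I^a` does not vanish do not depend
on `a`, for `a` large. -/
theorem exists_finset_hasKoszulHomology_iff {m : ℕ} {I : Fin m → Ideal (MvPolynomial (Fin n) K)}
    {d : Fin m → ℕ} (hd : ∀ i, GeneratedInDegree (I i) (d i)) (j : ℕ) :
    ∃ (V : Finset ℤ) (b : Fin m → ℕ), ∀ a, b ≤ a → ∀ v,
      HasKoszulHomology (varSeq K n) (idealForms (prodPow I a)) n j (dotDegree d a + v) ↔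
        v ∈ V := by
  classical
  have hgen : ∀ a, GeneratedInDegree (prodPow I a) (∑ i, d i * a i) :=
    GeneratedInDegree.prodPow hd
  let cyc : (Fin m → ℕ) → ℤ → (KoszulIndex n → MvPolynomial (Fin n) K) → Prop := fun a v z =>
    z ∈ koszulStrand (idealForms (prodPow I a)) n j (dotDegree d a + v - j) ∧
      koszulD (varSeq K n) _ n z = 0
  let B : (Fin m → ℕ) → ℤ → Submodule K (KoszulIndex n → MvPolynomial (Fin n) K) := fun a v =>
    koszulBoundary (varSeq K n) (idealForms (prodPow I a)) n j (dotDegree d a + v - j - 1)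
  have hBadd : ∀ a b v f z, f ∈ idealForms (prodPow I a) (dotDegree d a) → z ∈ B b v →
      f • z ∈ B (a + b) v := fun a b v f z hf hz => by
    have := smul_mem_koszulBoundary_idealForms hf hz
    rw [← prodPow_add, show dotDegree d a + (dotDegree d b + v - j - 1) =
      dotDegree d (a + b) + v - j - 1 by rw [dotDegree_add]; ring] at this
    exact this
  obtain ⟨t, ht, hspan⟩ := exists_finset_generators I {g | ∃ v, cyc g.1 v g.2}
    fun g ⟨v, hv⟩ q => (hv.1 q).1.2
  choose! v₀ hv₀ using fun s (hs : s ∈ t) => ht hs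
  -- A generator is alive if its class is never annihilated by all least-degree forms of any `I^b`;
  -- a dead one comes with a `b₀ s` where annihilation occurs.
  let alive : (Fin m → ℕ) × (KoszulIndex n → MvPolynomial (Fin n) K) → Prop := fun s =>
    ∀ b, ∃ f ∈ idealForms (prodPow I b) (dotDegree d b), f • s.2 ∉ B (b + s.1) (v₀ s)
  have hdead : ∀ s, ∃ b, ¬alive s → ∀ f ∈ idealForms (prodPow I b) (dotDegree d b),
      f • s.2 ∈ B (b + s.1) (v₀ s) := fun s => by
    by_cases h : alive s
    · exact ⟨0, fun h' => (h' h).elim⟩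
    · have h' := h
      simp only [alive] at h'
      push Not at h'
      obtain ⟨b, hb⟩ := h'
      exact ⟨b, fun _ => hb⟩
  choose b₀ hb₀ using hdead
  -- The bound dominates every `b₀ s + s.1`, so that `I^(a - s.1)` contains the factor `I^(b₀ s)`
  -- for each generator.
  refine ⟨(t.filter alive).image v₀, ∑ s ∈ t, (b₀ s + s.1), fun a ha v => ?_⟩
  have hle : ∀ s ∈ t, b₀ s + s.1 ≤ a := fun s hs =>
    (Finset.single_le_sum (f := fun s => b₀ s + s.1) (fun _ _ => zero_le) hs).trans ha
  have hsub : ∀ s ∈ t, ∃ c, a = c + b₀ s + s.1 := fun s hs =>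
    ⟨a - (b₀ s + s.1), by rw [add_assoc, tsub_add_cancel_of_le (hle s hs)]⟩
  constructor
  · rintro ⟨z, hz, hD, hzB⟩
    by_contra hv
    refine hzB ?_
    obtain ⟨f, hf, hfz⟩ := hspan (a, z) ⟨v, hz, hD⟩
    -- Both `z` and the generators are homogeneous, so only the component of `f s` in the difference
    -- of their degrees matters.
    have hz' : z = ∑ s ∈ t, polyProj K n (dotDegree d (a - s.1) + (v - v₀ s)) (f s) • s.2 := by
      funext q
      rw [← polyProj_of_mem (hz q).1.1, show z = _ from hfz, Finset.sum_apply, map_sum,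
        Finset.sum_apply]
      refine Finset.sum_congr rfl fun s hs => ?_
      rw [Pi.smul_apply, smul_eq_mul, polyProj_mul _ _ ((hv₀ s hs).1 q).1.1]
      obtain ⟨c, rfl⟩ := hsub s hs
      rw [add_tsub_cancel_right, dotDegree_add _ _ s.1, Pi.smul_apply, smul_eq_mul]
      congr 3
      ring
    rw [hz']
    refine sum_mem fun s hs => ?_
    obtain ⟨c, rfl⟩ := hsub s hs
    have hfs := hf s (le_add_of_nonneg_left zero_le)
    simp only [add_tsub_cancel_right] at hfs ⊢
    set e := c + b₀ s with he
    have hg : polyProj K n (dotDegree d e + (v - v₀ s)) (f s) ∈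
        idealForms (prodPow I e) (dotDegree d e + (v - v₀ s)) :=
      ⟨polyProj_mem _ _, (hgen e).polyProj_mem _ hfs _⟩
    generalize polyProj K n (dotDegree d e + (v - v₀ s)) (f s) = g at hg
    have hcast := natCast_sum_mul d
    obtain ⟨hs1, hs2⟩ := hv₀ s hs
    -- The coefficient has degree below, at, or above the generating degree of `I^e`: it is zero, it
    -- kills the dead class of `s`, or it lies in `𝔪 I^e`.
    rcases lt_trichotomy v (v₀ s) with hlt | heq | hgt
    · rw [(hgen e).eq_zero_of_lt (by rw [hcast]; omega) hg, zero_smul]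
      exact zero_mem _
    · have hna : ¬alive s := fun h => hv (Finset.mem_image.2
        ⟨s, Finset.mem_filter.2 ⟨hs, h⟩, heq.symm⟩)
      rw [heq, sub_self, add_zero, he, prodPow_add] at hg
      have hg' := (hgen c).mem_span_mul (hgen (b₀ s)) (by rw [hcast, hcast, dotDegree_add]) hg
      rw [heq]
      change g • s.2 ∈ B (e + s.1) (v₀ s)
      refine Submodule.span_induction ?_ ?_ ?_ ?_ hg'
      · rintro _ ⟨g, hg, g', hg', rfl⟩
        rw [hcast] at hg hg'
        rw [mul_smul, he, add_assoc]
        exact hBadd _ _ _ _ _ hg (hb₀ s hna _ hg')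
      · rw [zero_smul]
        exact zero_mem _
      · intro x y _ _ hx hy
        rw [add_smul]
        exact add_mem hx hy
      · intro r x _ hx
        rw [smul_assoc]
        exact Submodule.smul_mem _ _ hx
    · obtain ⟨c', hc', rfl⟩ := (hgen e).exists_sum_of_gt (by rw [hcast]; omega) hg
      rw [Finset.sum_smul]
      refine sum_mem fun i hi => ?_
      rw [mul_smul]
      refine smul_mem_koszulBoundary _ (Finset.mem_range.1 hi) ?_ (by rw [map_smul, hs2, smul_zero])
      have := smul_mem_koszulStrand (hc' i) hs1
      rw [← prodPow_add] at this
      convert this using 2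
      rw [dotDegree_add]
      ring
  · intro hv
    obtain ⟨s, hs, rfl⟩ := Finset.mem_image.1 hv
    obtain ⟨hs, hal⟩ := Finset.mem_filter.1 hs
    obtain ⟨c, rfl⟩ := hsub s hs
    obtain ⟨f, hf, hfB⟩ := hal (c + b₀ s)
    obtain ⟨hs1, hs2⟩ := hv₀ s hs
    refine ⟨f • s.2, ?_, by rw [map_smul, hs2, smul_zero], hfB⟩
    have := smul_mem_koszulStrand hf hs1
    rw [← prodPow_add] at this
    convert this using 2
    rw [dotDegree_add _ _ s.1]
    ring

end Asymptotics

/-! ### From Koszul degrees to syzygy degrees and regularity -/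

section Conclusion

variable {K : Type*} [Field K] {n : ℕ}

namespace MinimalGradedFreeResolution

variable {J : Ideal (MvPolynomial (Fin n) K)}

theorem rank_ne_zero_iff (F : MinimalGradedFreeResolution (n := n) (idealComp J)) {j : ℕ} {c : ℤ}
    {W : Finset ℤ} (hW : ∀ v, HasKoszulHomology (varSeq K n) (idealForms J) n j (c + v) ↔ v ∈ W) :
    F.rank j ≠ 0 ↔ W.Nonempty := by
  constructor
  · intro h
    refine ⟨F.deg j ⟨0, Nat.pos_of_ne_zero h⟩ - c, (hW _).1 ?_⟩
    rw [add_sub_cancel, F.hasKoszulHomology_iff]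
    exact ⟨_, rfl⟩
  · rintro ⟨v, hv⟩ h
    obtain ⟨k, -⟩ := (F.hasKoszulHomology_iff _ _).1 ((hW v).2 hv)
    rw [h] at k
    exact k.elim0

theorem rank_zero_ne_zero (F : MinimalGradedFreeResolution (n := n) (idealComp J)) (hJ : J ≠ ⊥) :
    F.rank 0 ≠ 0 := by
  intro h
  have : IsEmpty (Fin (F.rank 0)) := by rw [h]; infer_instance
  have : Subsingleton J := F.aug_surjective.subsingleton
  exact hJ (Submodule.subsingleton_iff_eq_bot.1 this)

end MinimalGradedFreeResolution

/-- All minimal resolutions share the degrees detected by Koszul homology, so the supremum over them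
is attained on any one; existence is needed for the lower bound. -/
theorem maxSyzygyDegree_eq {J : Ideal (MvPolynomial (Fin n) K)}
    (hJ : Nonempty (MinimalGradedFreeResolution (n := n) (idealComp J))) {j : ℕ} {c : ℤ}
    {W : Finset ℤ} (hW : ∀ v, HasKoszulHomology (varSeq K n) (idealForms J) n j (c + v) ↔ v ∈ W)
    (h : W.Nonempty) :
    maxSyzygyDegree (n := n) (idealComp J) j = (((c + W.max' h : ℤ) : ℝ) : EReal) := by
  apply le_antisymm
  · refine iSup₂_le fun F k => ?_
    have hk : F.deg j k - c ∈ W := by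
      rw [← hW, add_sub_cancel, F.hasKoszulHomology_iff]
      exact ⟨k, rfl⟩
    have := W.le_max' _ hk
    exact_mod_cast (by omega : F.deg j k ≤ c + W.max' h)
  · obtain ⟨F⟩ := hJ
    obtain ⟨k, hk⟩ := (F.hasKoszulHomology_iff _ _).1 ((hW _).2 (W.max'_mem h))
    rw [← hk]
    exact le_iSup₂ (f := fun (F : MinimalGradedFreeResolution (n := n) (idealComp J))
      (k : Fin (F.rank j)) => ((F.deg j k : ℝ) : EReal)) F k

theorem maxSyzygyDegree_eq_bot {J : Ideal (MvPolynomial (Fin n) K)} {j : ℕ}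
    (hW : ∀ v, ¬HasKoszulHomology (varSeq K n) (idealForms J) n j v) :
    maxSyzygyDegree (n := n) (idealComp J) j = ⊥ := by
  rw [eq_bot_iff]
  exact iSup₂_le fun F k => (hW _ ((F.hasKoszulHomology_iff _ _).2 ⟨k, rfl⟩)).elim

theorem prodPow_ne_bot {m : ℕ} {I : Fin m → Ideal (MvPolynomial (Fin n) K)}
    (hI : ∀ i, I i ≠ ⊥) (a : Fin m → ℕ) : prodPow I a ≠ ⊥ :=
  Finset.prod_ne_zero_iff.2 fun i _ => pow_ne_zero _ (hI i)

theorem gradedRegularity_eq {J : Ideal (MvPolynomial (Fin n) K)} {p : ℕ} {c : ℤ} {M : ℕ → ℤ}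
    (h : ∀ j ≤ p, maxSyzygyDegree (n := n) (idealComp J) j = (((c + M j : ℤ) : ℝ) : EReal))
    (h' : ∀ j, p < j → maxSyzygyDegree (n := n) (idealComp J) j = ⊥) {i : ℕ} (hi : i ≤ p)
    (hmax : ∀ j ≤ p, M j - j ≤ M i - i) :
    gradedRegularity (n := n) (idealComp J) = (((c + (M i - i) : ℤ) : ℝ) : EReal) := by
  have key : ∀ j ≤ p, maxSyzygyDegree (n := n) (idealComp J) j - (j : EReal) =
      (((c + (M j - j) : ℤ) : ℝ) : EReal) := fun j hj => by
    rw [h j hj, ← EReal.coe_natCast, ← EReal.coe_sub]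
    congr 1
    push_cast
    ring
  apply le_antisymm
  · refine iSup_le fun j => ?_
    rcases le_or_gt j p with hj | hj
    · rw [key j hj]
      have := hmax j hj
      exact_mod_cast (by omega : c + (M j - j) ≤ c + (M i - i))
    · rw [h' j hj, EReal.bot_sub]
      exact bot_le
  · rw [← key i hi]
    exact le_iSup (fun j : ℕ => maxSyzygyDegree (n := n) (idealComp J) j - (j : EReal)) i

end Conclusion

theorem corollary2 {K : Type*} [Field K] (n m : ℕ)
    (I : Fin m → Ideal (MvPolynomial (Fin n) K)) (hI : ∀ i, I i ≠ ⊥)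
    (d : Fin m → ℕ) (hd : ∀ i, GeneratedInDegree (I i) (d i)) :
    ∃ p : ℕ,
      (∃ b : Fin m → ℕ, ∀ a : Fin m → ℕ, b ≤ a →
        CategoryTheory.projectiveDimension
          (ModuleCat.of (MvPolynomial (Fin n) K) (prodPow I a)) = (p : WithBot ℕ∞)) ∧
      (∀ j : ℕ, j ≤ p → ∃ l : ℤ, ∃ b : Fin m → ℕ, ∀ a : Fin m → ℕ, b ≤ a →
        maxSyzygyDegree (n := n) (idealComp (prodPow I a)) j =
          (((∑ i, (d i : ℤ) * (a i : ℤ) + l : ℤ) : ℝ) : EReal)) ∧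
      (∃ l : ℤ, ∃ b : Fin m → ℕ, ∀ a : Fin m → ℕ, b ≤ a →
        gradedRegularity (n := n) (idealComp (prodPow I a)) =
          (((∑ i, (d i : ℤ) * (a i : ℤ) + l : ℤ) : ℝ) : EReal)) := by
  classical
  have hres : ∀ a, Nonempty (MinimalGradedFreeResolution (n := n) (idealComp (prodPow I a))) :=
    fun a => nonempty_minimalGradedFreeResolution (GeneratedInDegree.prodPow hd a).polyProj_mem
  obtain ⟨W, b, hW⟩ : ∃ (W : ℕ → Finset ℤ) (b : Fin m → ℕ), ∀ a, b ≤ a → ∀ j v,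
      HasKoszulHomology (varSeq K n) (idealForms (prodPow I a)) n j (dotDegree d a + v) ↔
        v ∈ W j := by
    choose V b hV using fun j => exists_finset_hasKoszulHomology_iff hd j
    -- Koszul homology vanishes beyond `n`, so finitely many bounds combine into one valid for all
    -- `j`.
    refine ⟨fun j => if j ≤ n then V j else ∅, ∑ j ∈ Finset.range (n + 1), b j,
      fun a ha j v => ?_⟩
    by_cases hj : j ≤ n
    · simp only [if_pos hj]
      refine hV j a (le_trans ?_ ha) v
      exact Finset.single_le_sum (fun _ _ => zero_le) (Finset.mem_range.2 (by omega))
    · simp only [if_neg hj]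
      exact iff_of_false (not_hasKoszulHomology _ (by omega) _) (Finset.notMem_empty _)
  have hrank : ∀ a, b ≤ a → ∀ (F : MinimalGradedFreeResolution (n := n) (idealComp (prodPow I a)))
      j, F.rank j ≠ 0 ↔ (W j).Nonempty := fun a ha F j => F.rank_ne_zero_iff (hW a ha j)
  obtain ⟨F₀⟩ := hres b
  have hW0 : (W 0).Nonempty :=
    (hrank b le_rfl F₀ 0).1 (F₀.rank_zero_ne_zero (prodPow_ne_bot hI b))
  have hWn : ∀ j, n < j → ¬(W j).Nonempty := by
    rintro j hj ⟨v, hv⟩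
    exact not_hasKoszulHomology _ hj _ ((hW b le_rfl j v).2 hv)
  let p := Nat.findGreatest (fun j => (W j).Nonempty) n
  have hp : (W p).Nonempty :=
    Nat.findGreatest_spec (P := fun j => (W j).Nonempty) (Nat.zero_le n) hW0
  have hp' : ∀ j, p < j → ¬(W j).Nonempty := fun j hj => by
    rcases le_or_gt j n with hjn | hjn
    · exact Nat.findGreatest_is_greatest hj hjn
    · exact hWn j hjn
  -- A minimal resolution has no gaps: nonzero rank at `p` forces nonzero rank at all earlier
  -- places. One exponent suffices because `W` is independent of `a`.
  have hlow : ∀ j ≤ p, (W j).Nonempty := fun j hj =>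
    (hrank b le_rfl F₀ j).1 (F₀.rank_ne_zero_of_le hj ((hrank b le_rfl F₀ p).2 hp))
  -- The default value is never used, as only `j ≤ p` occurs below.
  let M : ℕ → ℤ := fun j => if h : (W j).Nonempty then (W j).max' h else 0
  have hM : ∀ a, b ≤ a → ∀ j ≤ p, maxSyzygyDegree (n := n) (idealComp (prodPow I a)) j =
      (((dotDegree d a + M j : ℤ) : ℝ) : EReal) := fun a ha j hj => by
    rw [maxSyzygyDegree_eq (hres a) (hW a ha j) (hlow j hj)]
    simp only [M, dif_pos (hlow j hj)]
  obtain ⟨i, hi, hmax⟩ := Finset.exists_max_image (Finset.range (p + 1)) (fun j => M j - j)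
    ⟨0, by simp⟩
  refine ⟨p, ⟨b, fun a ha => ?_⟩, fun j hj => ⟨M j, b, fun a ha => hM a ha j hj⟩,
    M i - i, b, fun a ha => ?_⟩
  · obtain ⟨F⟩ := hres a
    refine F.projectiveDimension_eq ((hrank a ha F p).2 hp) ?_
    by_contra h
    exact hp' (p + 1) (Nat.lt_succ_self p) ((hrank a ha F (p + 1)).1 h)
  · refine gradedRegularity_eq (hM a ha) (fun j hj => maxSyzygyDegree_eq_bot fun v hv => ?_)
      (by simpa [Nat.lt_succ_iff] using hi)
      fun j hj => hmax j (Finset.mem_range.2 (Nat.lt_succ_of_le hj))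
    refine hp' j hj ⟨v - dotDegree d a, (hW a ha j _).1 ?_⟩
    rwa [add_sub_cancel]
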